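/- Let $\phi,\psi:[0,1]\to\mathbb R$ be continuous on $[0,1]$ and three times continuously differentiable on $(0,1]$ (derivatives at $1$ being one-sided), and assume: - $\phi$ is concave, $\phi(0)=\phi(1)=0$ and $-1<\phi'(1)<0$; - $\psi$ is convex, $\psi(1)=0$, $\psi'(1)<0$ and $\psi''(1)-\phi''(1)>0$; - $\phi'''(x)\ge 0$ and $\psi'''(x)\le 0$ for $0<x\le 1$; - $\lim_{x\to 0^+}\phi(x)/x=\infty$. Let $c_0\ge 0$ be an integrable function on $[0,1)$, and put $w_0(x)=\int_x^1c_0(x')\,dx'$ and $h_0(x)=\int_x^1 w_0(x')\,dx'$ for $0\le x<1$. Assume that $w_0(x)>0$ for $0\le x<1$, that $\int_0^1w_0(x)\,dx=1$, and that the beta function $\beta(x,0)=c_0(x)h_0(x)/w_0(x)^2$ satisfies $\lim_{x\to1^-}\beta(x,0)=\beta_0$ with $0<\beta_0\le 1$. Then there is a constant $C>0$, depending only on the initial data $w_0$ (and on the fixed coefficients $\phi,\psi$), with the following property. Let $\kappa:[0,\infty)\to\mathbb R$ be continuous and let $w(x,t)$, $0\le x<1$, $t\ge0$, be non-negative and decreasing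 in $x$ for every $t$, with $w(\cdot,0)=w_0$, and such that $$\frac{\partial w}{\partial t}(x,t)+[\phi(x)-\kappa(t)\psi(x)]\frac{\partial w}{\partial x}(x,t)=w(x,t),\qquad \int_0^1w(x,t)\,dx=1,\qquad 0\le x<1,\ t\ge 0,$$ where the differential equation is understood along characteristics: $\frac{d}{ds}w(x(s),s)=w(x(s),s)$ along every curve $x(s)\in[0,1)$ with $\frac{dx}{ds}=\phi(x(s))-\kappa(s)\psi(x(s))$. Then $\kappa(t)\ge C$ for all $t\ge0$. -/

import Mathlib

open Set Filter Topology MeasureTheory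

namespace LSW

/-- The conditions on the coefficients `φ, ψ : [0,1] → ℝ`: both are continuous on `[0,1]` and `C²` on
`(0,1]`; `φ` is concave with `φ(0) = φ(1) = 0` and `-1 < φ'(1) < 0`; `ψ` is convex with `ψ(1) = 0`,
`ψ'(1) < 0`; and `ψ''(1) - φ''(1) > 0`.  Derivatives at the end point `1` are one-sided. -/
structure IsCoefficientPair (φ ψ : ℝ → ℝ) : Prop where
  continuousOn_phi : ContinuousOn φ (Icc 0 1)
  continuousOn_psi : ContinuousOn ψ (Icc 0 1)
  contDiffOn_phi : ContDiffOn ℝ 2 φ (Ioc 0 1)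
  contDiffOn_psi : ContDiffOn ℝ 2 ψ (Ioc 0 1)
  concaveOn_phi : ConcaveOn ℝ (Icc 0 1) φ
  phi_zero : φ 0 = 0
  phi_one : φ 1 = 0
  neg_one_lt_deriv_phi : -1 < derivWithin φ (Ioc 0 1) 1
  deriv_phi_neg : derivWithin φ (Ioc 0 1) 1 < 0
  convexOn_psi : ConvexOn ℝ (Icc 0 1) ψ
  psi_one : ψ 1 = 0
  deriv_psi_neg : derivWithin ψ (Ioc 0 1) 1 < 0
  second_deriv_pos :
    0 < iteratedDerivWithin 2 ψ (Ioc 0 1) 1 - iteratedDerivWithin 2 φ (Ioc 0 1) 1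

/-- `φ, ψ` are `C³` on `(0,1]` with `φ''' ≥ 0` and `ψ''' ≤ 0` there. -/
structure HasSignedThirdDerivatives (φ ψ : ℝ → ℝ) : Prop where
  contDiffOn_phi : ContDiffOn ℝ 3 φ (Ioc 0 1)
  contDiffOn_psi : ContDiffOn ℝ 3 ψ (Ioc 0 1)
  third_deriv_phi : ∀ x ∈ Ioc (0 : ℝ) 1, 0 ≤ iteratedDerivWithin 3 φ (Ioc 0 1) x
  third_deriv_psi : ∀ x ∈ Ioc (0 : ℝ) 1, iteratedDerivWithin 3 ψ (Ioc 0 1) x ≤ 0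

/-- The tail integral `x ↦ ∫_x^1 f`.  For a density `c` on `[0,1)`, `tail c` is the function `w`
and `tail (tail c)` is the function `h`. -/
noncomputable def tail (f : ℝ → ℝ) (x : ℝ) : ℝ := ∫ y in x..1, f y

/-- The beta function `β = c h / w²` of the density `c`. -/
noncomputable def betaFunction (c : ℝ → ℝ) (x : ℝ) : ℝ :=
  c x * tail (tail c) x / (tail c x) ^ 2

/-- Initial data, given by its density `c₀`, so that `w₀(x) = ∫_x^1 c₀`: the density is non-negative
and integrable, `w₀` is strictly positive on `[0,1)`, and `∫_0^1 w₀ = 1`.  (Then `w₀` is decreasing,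
continuous, and tends to `0` at `1`.) -/
structure IsInitialDensity (c₀ : ℝ → ℝ) : Prop where
  nonneg : ∀ x ∈ Ico (0 : ℝ) 1, 0 ≤ c₀ x
  integrable : IntervalIntegrable c₀ volume 0 1
  tail_pos : ∀ x ∈ Ico (0 : ℝ) 1, 0 < tail c₀ x
  mass : tail (tail c₀) 0 = 1

/-- `X` is a characteristic curve on the time interval `[a,b]`, lying in `[0,1)`:
`X'(s) = φ(X(s)) - κ(s) ψ(X(s))`. -/
def IsCharacteristic (φ ψ κ : ℝ → ℝ) (a b : ℝ) (X : ℝ → ℝ) : Prop :=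
  ∀ s ∈ Icc a b, X s ∈ Ico (0 : ℝ) 1 ∧
    HasDerivWithinAt X (φ (X s) - κ s * ψ (X s)) (Icc a b) s

/-- The pair `(w, κ)`, with `w = w(x,t)`, solves
`∂w/∂t + [φ(x) - κ(t) ψ(x)] ∂w/∂x = w` on `0 ≤ x < 1`, `t ≥ 0`, together with the conservation law
`∫_0^1 w(x,t) dx = 1`, with initial value `w₀(x) = ∫_x^1 c₀`.

Each `w(·,t)` is, as a tail integral of a non-negative density, non-negative and decreasing.  Since
`w₀` need not be differentiable everywhere, the left side of the equation is read as the
derivative of `w` in the direction `(φ - κ ψ, 1)`, that is, along the characteristic curves; for a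
differentiable `w` this is the equation itself, by the chain rule. -/
structure IsSolution (φ ψ c₀ : ℝ → ℝ) (w : ℝ → ℝ → ℝ) (κ : ℝ → ℝ) : Prop where
  continuousOn_kappa : ContinuousOn κ (Ici 0)
  initial : ∀ x ∈ Ico (0 : ℝ) 1, w x 0 = tail c₀ x
  nonneg : ∀ t, 0 ≤ t → ∀ x ∈ Ico (0 : ℝ) 1, 0 ≤ w x t
  antitone : ∀ t, 0 ≤ t → AntitoneOn (fun x => w x t) (Ico 0 1)
  transport : ∀ a b, 0 ≤ a → a < b → ∀ X : ℝ → ℝ, IsCharacteristic φ ψ κ a b X →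
    ∀ s ∈ Icc a b, HasDerivWithinAt (fun r => w (X r) r) (w (X s) s) (Icc a b) s
  mass : ∀ t, 0 ≤ t → ∫ x in (0 : ℝ)..1, w x t = 1

end LSW

/-!
Conservation of mass alone bounds `κ` from below by `1 / (ψ(0) sup w)`: the mass grows at rate `1`,
and it is lost only through the end point `0`, where the speed is `κ ψ(0)`
(`IsSolution.one_le_kappa_mul`). So the point is to bound `w` uniformly, in terms of the
coefficients and of `w₀` only (`exists_uniform_bound`).

Conversely, at a time when `κ ≥ k > 0`, conservation of mass bounds `w (·, s)` by a constant
depending on `k`, since the velocity is then bounded away from `0` near `x = 0` and a large `w`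
would let too much mass escape (`exists_le_of_le_kappa`). To reach such a time, follow the
characteristic through `(1/2, t)` backwards to the first time `s` at which it is in `(0, 1/2]`. If
`s = 0`, then `w (x, t) / w (1/2, t)` is a quotient of values of `w₀`, with denominator at least
`w₀ (1/2)`, while `w (1/2, t) ≤ 2` by mass. If `s > 0`, the curve `Z` crosses `1/2` leftwards at
time `s`, so `κ(s) ≥ φ(1/2) / ψ(1/2)` and `w (·, s) ≤ N`. As
`w (x, t) / w (1/2, t) ≤ N / w (1/2, s)`, it remains to bound `w (1/2, s)` from below.

At least half of the mass at time `s` lies to the right of `a = 1 / (2 N)`, so `w (a, s) ≥ 1/2`.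
Let `X`, `Y`, `Z` be the characteristics that at time `s` are at `a / 2`, `a`, `1/2`. The values of
`w₀` at `X(0)` and `Y(0)` are comparable, because `w (a/2, s) ≤ N` and `w (a, s) ≥ 1/2`, and the
value at `Z(0)` is wanted. Two facts give it.

* The ratio `(Z - X) / (Y - X)` at time `0` is bounded whatever `κ` is (`exists_distortion_bound`).
  The signs of the third derivatives make `log ((1 - X) / (1 - Z))` increase at rate at least
  `(κ l₁ + l₂) (Z - X)`, where `2 l₁ = ψ''(1) ≥ 0`, `2 l₂ = -φ''(1) ≥ 0` and `l₁ + l₂ > 0`. This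
  keeps all three curves to the right of `a / 2`, where the coefficients have bounded second
  derivatives, so that `log ((Z - X) / (Y - X))` decreases at rate at most `Λ (1 + κ) (Z - X)`.
  Adding suitable multiples of `log ((1 - X) / (1 - Z))`, `Z - X` and `1 / Z - 1 / X`, all of which
  stay bounded, yields an increasing function; the last two are there because `l₁` or `l₂` may
  vanish.
* The tail `w₀` is regular at the end point `1` (`IsInitialDensity.exists_tail_ge`): with
  `m = h₀ / w₀` one has `m' = β - 1` and `(log w₀)' = -β / m`, so as `β → β₀ > 0` a bounded loss of
  `w₀` over `[X, Y]` forces `Y - X`, and hence `Z - X`, to be at most a multiple of `m(X)`. On an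
  interval of this length `m` remains comparable to `m(X)`, and `w₀` loses at most a fixed factor.
-/

namespace LSW

/-! ### Convexity and third derivatives of a single coefficient -/

/-- A convex function lies above its tangent at `1` by an amount that decreases towards `1`. -/
lemma antitoneOn_sub_mul_of_convexOn {f : ℝ → ℝ} {d : ℝ} (hf : ConvexOn ℝ (Icc 0 1) f)
    (hd : HasDerivWithinAt f d (Ioc 0 1) 1) : AntitoneOn (fun x => f x - d * x) (Icc 0 1) := by
  have h1 : ∀ x ∈ Ico (0 : ℝ) 1, slope f x 1 ≤ d := fun x hx =>
    hf.slope_le_of_hasDerivWithinAt_Iio ⟨hx.1, hx.2.le⟩ (by simp) hx.2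
      (hd.mono_of_mem_nhdsWithin (Ioc_mem_nhdsLT (by norm_num : (0 : ℝ) < 1)))
  intro x hx y hy hxy
  rcases hxy.eq_or_lt with rfl | hlt
  · exact le_rfl
  have hs : slope f x y ≤ d := by
    rcases hy.2.eq_or_lt with rfl | hy1
    · exact h1 x ⟨hx.1, hlt⟩
    · refine le_trans ?_ (h1 y ⟨hy.1, hy1⟩)
      rw [slope_def_field, slope_def_field]
      exact hf.slope_mono_adjacent hx (by simp) hlt hy1
  rw [slope_def_field, div_le_iff₀ (by linarith)] at hs
  show f y - d * y ≤ f x - d * x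
  linarith

section SecondDerivative

variable {f : ℝ → ℝ}

lemma antitoneOn_iteratedDerivWithin_two (hf : ContDiffOn ℝ 3 f (Ioc 0 1))
    (h3 : ∀ x ∈ Ioc (0 : ℝ) 1, iteratedDerivWithin 3 f (Ioc 0 1) x ≤ 0) :
    AntitoneOn (iteratedDerivWithin 2 f (Ioc 0 1)) (Ioc 0 1) := by
  have hu : UniqueDiffOn ℝ (Ioc (0 : ℝ) 1) := uniqueDiffOn_Ioc 0 1
  have hd : DifferentiableOn ℝ (iteratedDerivWithin 2 f (Ioc 0 1)) (Ioc 0 1) :=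
    hf.differentiableOn_iteratedDerivWithin (by norm_cast) hu
  refine antitoneOn_of_deriv_nonpos (convex_Ioc 0 1) hd.continuousOn
    (hd.mono interior_subset) fun x hx => ?_
  have hx' : x ∈ Ioc (0 : ℝ) 1 := interior_subset hx
  have := h3 x hx'
  rwa [iteratedDerivWithin_succ, derivWithin_of_mem_nhds (mem_interior_iff_mem_nhds.1 hx)] at this

lemma hasDerivAt_of_contDiffOn {n : WithTop ℕ∞} (hf : ContDiffOn ℝ n f (Ioc 0 1))
    (hn : 2 ≤ n) {x : ℝ} (hx : x ∈ Ioo (0 : ℝ) 1) :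
    HasDerivAt f (derivWithin f (Ioc 0 1) x) x ∧
      HasDerivAt (derivWithin f (Ioc 0 1)) (iteratedDerivWithin 2 f (Ioc 0 1) x) x := by
  have hu : UniqueDiffOn ℝ (Ioc (0 : ℝ) 1) := uniqueDiffOn_Ioc 0 1
  have hm : Ioc (0 : ℝ) 1 ∈ 𝓝 x := Ioc_mem_nhds hx.1 hx.2
  have hx' : x ∈ Ioc (0 : ℝ) 1 := ⟨hx.1, hx.2.le⟩
  have hn1 : (1 : WithTop ℕ∞) ≤ n := le_trans (by norm_num) hn
  constructor
  · exact ((hf.differentiableOn (by positivity) x hx').hasDerivWithinAt).hasDerivAt hm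
  · have hd : DifferentiableOn ℝ (iteratedDerivWithin 1 f (Ioc 0 1)) (Ioc 0 1) :=
      hf.differentiableOn_iteratedDerivWithin (lt_of_lt_of_le (by norm_cast) hn) hu
    have he : iteratedDerivWithin 1 f (Ioc 0 1) = derivWithin f (Ioc 0 1) := by
      ext y; rw [iteratedDerivWithin_one]
    rw [he] at hd
    have := ((hd x hx').hasDerivWithinAt).hasDerivAt hm
    rwa [iteratedDerivWithin_succ, he]

/-- Since `f''` decreases, it is smallest at `1`. -/
lemma convexOn_sub_sq (hf : ContDiffOn ℝ 3 f (Ioc 0 1))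
    (h3 : ∀ x ∈ Ioc (0 : ℝ) 1, iteratedDerivWithin 3 f (Ioc 0 1) x ≤ 0) :
    ConvexOn ℝ (Ioc 0 1)
      (fun x => f x - iteratedDerivWithin 2 f (Ioc 0 1) 1 / 2 * x ^ 2) := by
  set μ := iteratedDerivWithin 2 f (Ioc 0 1) 1 with hμ
  have hanti := antitoneOn_iteratedDerivWithin_two hf h3
  refine convexOn_of_hasDerivWithinAt2_nonneg (convex_Ioc 0 1)
    (f' := fun x => derivWithin f (Ioc 0 1) x - μ * x)
    (f'' := fun x => iteratedDerivWithin 2 f (Ioc 0 1) x - μ)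
    (hf.continuousOn.sub (by fun_prop)) ?_ ?_ ?_
  · intro x hx
    rw [interior_Ioc] at hx
    obtain ⟨h1, -⟩ := hasDerivAt_of_contDiffOn hf (by norm_cast) hx
    have h2 : HasDerivAt (fun x : ℝ => μ / 2 * x ^ 2) (μ * x) x := by
      have := (hasDerivAt_pow 2 x).const_mul (μ / 2)
      refine this.congr_deriv ?_
      simp; ring
    exact (h1.sub h2).hasDerivWithinAt
  · intro x hx
    rw [interior_Ioc] at hx
    obtain ⟨-, h1⟩ := hasDerivAt_of_contDiffOn hf (by norm_cast) hx
    have h2 : HasDerivAt (fun x : ℝ => μ * x) μ x := by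
      simpa using (hasDerivAt_id x).const_mul μ
    exact (h1.sub h2).hasDerivWithinAt
  · intro x hx
    have hx' : x ∈ Ioc (0 : ℝ) 1 := interior_subset hx
    exact sub_nonneg.2 (hanti hx' (by simp) hx'.2)

/-- Since `f''` decreases, it is largest at the left end point `ξ`. -/
lemma concaveOn_sub_sq (hf : ContDiffOn ℝ 3 f (Ioc 0 1))
    (h3 : ∀ x ∈ Ioc (0 : ℝ) 1, iteratedDerivWithin 3 f (Ioc 0 1) x ≤ 0) {ξ : ℝ}
    (hξ : ξ ∈ Ioc (0 : ℝ) 1) :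
    ConcaveOn ℝ (Icc ξ 1)
      (fun x => f x - iteratedDerivWithin 2 f (Ioc 0 1) ξ / 2 * x ^ 2) := by
  set μ := iteratedDerivWithin 2 f (Ioc 0 1) ξ with hμ
  have hanti := antitoneOn_iteratedDerivWithin_two hf h3
  have hsub : Icc ξ 1 ⊆ Ioc (0 : ℝ) 1 := fun x hx => ⟨hξ.1.trans_le hx.1, hx.2⟩
  refine concaveOn_of_hasDerivWithinAt2_nonpos (convex_Icc ξ 1)
    (f' := fun x => derivWithin f (Ioc 0 1) x - μ * x)
    (f'' := fun x => iteratedDerivWithin 2 f (Ioc 0 1) x - μ)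
    ((hf.continuousOn.mono hsub).sub (by fun_prop)) ?_ ?_ ?_
  · intro x hx
    rw [interior_Icc] at hx
    obtain ⟨h1, -⟩ := hasDerivAt_of_contDiffOn hf (by norm_cast) ⟨hξ.1.trans hx.1, hx.2⟩
    have h2 : HasDerivAt (fun x : ℝ => μ / 2 * x ^ 2) (μ * x) x := by
      have := (hasDerivAt_pow 2 x).const_mul (μ / 2)
      refine this.congr_deriv ?_
      simp; ring
    exact (h1.sub h2).hasDerivWithinAt
  · intro x hx
    rw [interior_Icc] at hx
    obtain ⟨-, h1⟩ := hasDerivAt_of_contDiffOn hf (by norm_cast) ⟨hξ.1.trans hx.1, hx.2⟩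
    have h2 : HasDerivAt (fun x : ℝ => μ * x) μ x := by
      simpa using (hasDerivAt_id x).const_mul μ
    exact (h1.sub h2).hasDerivWithinAt
  · intro x hx
    have hx' : x ∈ Icc ξ 1 := interior_subset hx
    exact sub_nonpos.2 (hanti hξ (hsub hx') hx'.1)

/-- The second derivative at `1` of a convex function is non-negative. -/
lemma iteratedDerivWithin_two_one_nonneg (hf : ContDiffOn ℝ 2 f (Ioc 0 1))
    (hc : ConvexOn ℝ (Icc 0 1) f) : 0 ≤ iteratedDerivWithin 2 f (Ioc 0 1) 1 := by
  have hm := (hc.subset Ioc_subset_Icc_self (convex_Ioc 0 1)).monotoneOn_derivWithin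
    (hf.differentiableOn (by norm_num))
  rw [iteratedDerivWithin_succ]
  have he : iteratedDerivWithin 1 f (Ioc 0 1) = derivWithin f (Ioc 0 1) := by
    ext y; rw [iteratedDerivWithin_one]
  rw [he]
  exact hm.derivWithin_nonneg

lemma exists_lipschitzOnWith_Icc (hf : ContDiffOn ℝ 2 f (Ioc 0 1)) {ξ : ℝ} (hξ : 0 < ξ) :
    ∃ K : NNReal, LipschitzOnWith K f (Icc ξ 1) := by
  have h : ContDiffOn ℝ 1 f (Icc ξ 1) :=
    (hf.of_le (by norm_num)).mono fun x hx => ⟨hξ.trans_le hx.1, hx.2⟩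
  exact (h.locallyLipschitzOn (convex_Icc ξ 1)).exists_lipschitzOnWith_of_compact isCompact_Icc

end SecondDerivative

/-! ### The coefficient pair -/

section Chords

variable {f : ℝ → ℝ} {μ ξ : ℝ}

/-- Up to sign, `f x / (1 - x)` is the slope of the chord from `x` to the zero `1` of `f`, and
`μ x` is what `μ x ^ 2` contributes to it. -/
lemma antitoneOn_div_one_sub (hf : ConvexOn ℝ (Ioc 0 1) (fun x => f x - μ * x ^ 2))
    (h1 : f 1 = 0) : AntitoneOn (fun x => f x / (1 - x) + μ * x) (Ioo 0 1) := by
  intro x hx y hy hxy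
  rcases hxy.eq_or_lt with rfl | hlt
  · exact le_rfl
  have hy1 : 0 < 1 - y := by linarith [hy.2]
  have hx1 : 0 < 1 - x := by linarith [hx.2]
  have h := hf.secant_mono (a := 1) (x := x) (y := y) (by simp) ⟨hx.1, hx.2.le⟩ ⟨hy.1, hy.2.le⟩
    hx.2.ne hy.2.ne hxy
  simp only [h1] at h
  have e : ∀ z : ℝ, 0 < 1 - z →
      (f z - μ * z ^ 2 - (0 - μ * 1 ^ 2)) / (z - 1) = -(f z / (1 - z) + μ * z) - μ := by
    intro z hz
    have : z - 1 ≠ 0 := by linarith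
    have h' : 1 - z ≠ 0 := hz.ne'
    rw [div_eq_iff this]
    field_simp
    ring
  rw [e x hx1, e y hy1] at h
  show f y / (1 - y) + μ * y ≤ f x / (1 - x) + μ * x
  linarith

lemma chord_sub_chord_le (hf : ConcaveOn ℝ (Icc ξ 1) (fun x => f x - μ * x ^ 2)) {x y z : ℝ}
    (hx : ξ ≤ x) (hxy : x < y) (hyz : y < z) (hz : z ≤ 1) :
    (f z - f x) / (z - x) - (f y - f x) / (y - x) ≤ μ * (z - y) := by
  have h := hf.neg.secant_mono (a := x) (x := y) (y := z) ⟨hx, by linarith⟩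
    ⟨by linarith, by linarith⟩ ⟨by linarith, hz⟩ hxy.ne' (hxy.trans hyz).ne' hyz.le
  have e : ∀ t : ℝ, x < t →
      ((-fun x => f x - μ * x ^ 2) t - (-fun x => f x - μ * x ^ 2) x) / (t - x)
        = -((f t - f x) / (t - x)) + μ * (t + x) := by
    intro t ht
    have : t - x ≠ 0 := by linarith
    simp only [Pi.neg_apply]
    field_simp
    ring
  rw [e y hxy, e z (hxy.trans hyz)] at h
  linarith

end Chords

section Coefficients

variable {φ ψ : ℝ → ℝ}

lemma IsCoefficientPair.phi_nonneg (h : IsCoefficientPair φ ψ) {x : ℝ} (hx : x ∈ Icc (0 : ℝ) 1) :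
    0 ≤ φ x := by
  have := h.concaveOn_phi.2 (by simp : (0 : ℝ) ∈ Icc (0 : ℝ) 1) (by simp : (1 : ℝ) ∈ Icc (0 : ℝ) 1)
    (sub_nonneg.2 hx.2) hx.1 (by ring)
  simpa [h.phi_zero, h.phi_one] using this

lemma IsCoefficientPair.phi_pos (h : IsCoefficientPair φ ψ) {x : ℝ} (hx : x ∈ Ioo (0 : ℝ) 1) :
    0 < φ x := by
  have hd : HasDerivWithinAt φ (derivWithin φ (Ioc 0 1) 1) (Ioc 0 1) 1 :=
    (h.contDiffOn_phi.differentiableOn (by norm_num) 1 (by simp)).hasDerivWithinAt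
  have hd' : HasDerivWithinAt φ (derivWithin φ (Ioc 0 1) 1) (Iio 1) 1 :=
    hd.mono_of_mem_nhdsWithin (Ioc_mem_nhdsLT (by norm_num : (0 : ℝ) < 1))
  rw [hasDerivWithinAt_iff_tendsto_slope' (by simp)] at hd'
  have hev : ∀ᶠ y in 𝓝[<] (1 : ℝ), slope φ 1 y < 0 := hd'.eventually (gt_mem_nhds h.deriv_phi_neg)
  have hev2 : ∀ᶠ y in 𝓝[<] (1 : ℝ), y ∈ Ioo x 1 := Ioo_mem_nhdsLT hx.2
  obtain ⟨y, hy, hxy, hy1⟩ := (hev.and hev2).exists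
  rw [slope_def_field, h.phi_one, sub_zero, div_lt_iff_of_neg (by linarith), zero_mul] at hy
  have hy0 : 0 < y := hx.1.trans hxy
  have hq : 0 ≤ 1 - x / y := by rw [sub_nonneg, div_le_one hy0]; exact hxy.le
  have := h.concaveOn_phi.2 (by simp : (0 : ℝ) ∈ Icc (0 : ℝ) 1)
    (⟨hy0.le, hy1.le⟩ : y ∈ Icc (0 : ℝ) 1) hq (div_nonneg hx.1.le hy0.le) (by ring)
  simp only [h.phi_zero, smul_eq_mul, mul_zero, zero_add] at this
  rw [div_mul_cancel₀ x hy0.ne'] at this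
  exact lt_of_lt_of_le (mul_pos (div_pos hx.1 hy0) hy) this

lemma IsCoefficientPair.monotoneOn_phi_add (h : IsCoefficientPair φ ψ) :
    MonotoneOn (fun x => φ x - derivWithin φ (Ioc 0 1) 1 * x) (Icc 0 1) := by
  have hd : HasDerivWithinAt φ (derivWithin φ (Ioc 0 1) 1) (Ioc 0 1) 1 :=
    (h.contDiffOn_phi.differentiableOn (by norm_num) 1 (by simp)).hasDerivWithinAt
  have := antitoneOn_sub_mul_of_convexOn h.concaveOn_phi.neg hd.neg
  intro x hx y hy hxy
  have h' := this hx hy hxy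
  simp only [Pi.neg_apply] at h'
  show φ x - _ * x ≤ φ y - _ * y
  linarith

lemma IsCoefficientPair.antitoneOn_psi_sub (h : IsCoefficientPair φ ψ) :
    AntitoneOn (fun x => ψ x - derivWithin ψ (Ioc 0 1) 1 * x) (Icc 0 1) :=
  antitoneOn_sub_mul_of_convexOn h.convexOn_psi
    (h.contDiffOn_psi.differentiableOn (by norm_num) 1 (by simp)).hasDerivWithinAt

lemma IsCoefficientPair.le_psi (h : IsCoefficientPair φ ψ) {x : ℝ} (hx : x ∈ Icc (0 : ℝ) 1) :
    -derivWithin ψ (Ioc 0 1) 1 * (1 - x) ≤ ψ x := by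
  have := h.antitoneOn_psi_sub hx (by simp : (1 : ℝ) ∈ Icc (0 : ℝ) 1) hx.2
  simp only [h.psi_one] at this
  linarith

lemma IsCoefficientPair.psi_nonneg (h : IsCoefficientPair φ ψ) {x : ℝ} (hx : x ∈ Icc (0 : ℝ) 1) :
    0 ≤ ψ x :=
  le_trans (mul_nonneg (by linarith [h.deriv_psi_neg]) (by linarith [hx.2])) (h.le_psi hx)

lemma IsCoefficientPair.psi_pos (h : IsCoefficientPair φ ψ) {x : ℝ} (hx : x ∈ Ico (0 : ℝ) 1) :
    0 < ψ x :=
  lt_of_lt_of_le (mul_pos (by linarith [h.deriv_psi_neg]) (by linarith [hx.2]))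
    (h.le_psi ⟨hx.1, hx.2.le⟩)

lemma IsCoefficientPair.psi_le (h : IsCoefficientPair φ ψ) {x : ℝ} (hx : x ∈ Icc (0 : ℝ) 1) :
    ψ x ≤ ψ 0 := by
  have := h.antitoneOn_psi_sub (by simp : (0 : ℝ) ∈ Icc (0 : ℝ) 1) hx hx.1
  simp only at this
  nlinarith [h.deriv_psi_neg, hx.1]

/-- Monotonicity of the relative velocities `ψ x / (1 - x)` and `φ x / (1 - x)` towards the fixed
point `1`. By the signs of the third derivatives, the curvatures on the whole interval are at least
their values `2 l₁` and `2 l₂` at the end point. -/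
lemma exists_curvature_bounds (h : IsCoefficientPair φ ψ) (h3 : HasSignedThirdDerivatives φ ψ) :
    ∃ l₁ l₂ : ℝ, 0 ≤ l₁ ∧ 0 ≤ l₂ ∧ 0 < l₁ + l₂ ∧
      AntitoneOn (fun x => ψ x / (1 - x) + l₁ * x) (Ioo 0 1) ∧
      MonotoneOn (fun x => φ x / (1 - x) - l₂ * x) (Ioo 0 1) := by
  refine ⟨iteratedDerivWithin 2 ψ (Ioc 0 1) 1 / 2, iteratedDerivWithin 2 (-φ) (Ioc 0 1) 1 / 2,
    ?_, ?_, ?_, ?_, ?_⟩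
  · have := iteratedDerivWithin_two_one_nonneg h.contDiffOn_psi h.convexOn_psi
    linarith
  · have := iteratedDerivWithin_two_one_nonneg (f := -φ) h.contDiffOn_phi.neg
      h.concaveOn_phi.neg
    linarith
  · have := h.second_deriv_pos
    rw [iteratedDerivWithin_neg]
    linarith
  · exact antitoneOn_div_one_sub (convexOn_sub_sq h3.contDiffOn_psi h3.third_deriv_psi) h.psi_one
  · have := antitoneOn_div_one_sub (convexOn_sub_sq (f := -φ) h3.contDiffOn_phi.neg (fun x hx => by
      rw [iteratedDerivWithin_neg]
      linarith [h3.third_deriv_phi x hx])) (by simp [h.phi_one])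
    intro x hx y hy hxy
    have h' := this hx hy hxy
    simp only [Pi.neg_apply, neg_div] at h' ⊢
    linarith

lemma exists_chord_bound (h3 : HasSignedThirdDerivatives φ ψ) {ξ : ℝ} (hξ : ξ ∈ Ioc (0 : ℝ) 1) :
    ∃ Λ : ℝ, 0 ≤ Λ ∧ ∀ x y z, ξ ≤ x → x < y → y < z → z ≤ 1 →
      (φ y - φ x) / (y - x) - (φ z - φ x) / (z - x) ≤ Λ * (z - y) ∧
      (ψ z - ψ x) / (z - x) - (ψ y - ψ x) / (y - x) ≤ Λ * (z - y) := by
  set m₁ := iteratedDerivWithin 2 ψ (Ioc 0 1) ξ / 2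
  set m₂ := iteratedDerivWithin 2 (-φ) (Ioc 0 1) ξ / 2
  refine ⟨max 0 (max m₁ m₂), le_max_left _ _, fun x y z hx hxy hyz hz => ?_⟩
  have hψ := chord_sub_chord_le (concaveOn_sub_sq h3.contDiffOn_psi h3.third_deriv_psi hξ)
    hx hxy hyz hz
  have hφ := chord_sub_chord_le (concaveOn_sub_sq (f := -φ) h3.contDiffOn_phi.neg (fun x hx => by
      rw [iteratedDerivWithin_neg]
      linarith [h3.third_deriv_phi x hx]) hξ) hx hxy hyz hz
  have hyz' : 0 ≤ z - y := by linarith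
  constructor
  · refine le_trans (le_trans (le_of_eq ?_) hφ) (mul_le_mul_of_nonneg_right
      ((le_max_right _ _).trans (le_max_right _ _)) hyz')
    simp only [Pi.neg_apply]
    ring
  · exact hψ.trans (mul_le_mul_of_nonneg_right
      ((le_max_left _ _).trans (le_max_right _ _)) hyz')

/-- On `[ξ, 1]` the function `φ / x²` decreases at a definite rate.  The exponent `2` makes the
numerator `x φ' - 2 φ` of its derivative negative: `x φ' ≤ φ` by concavity, `φ > 0` inside, and
`φ' (1) < 0` at the end point. -/
lemma IsCoefficientPair.exists_antitoneOn_phi_div_sq (h : IsCoefficientPair φ ψ) {ξ : ℝ}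
    (hξ : ξ ∈ Ioc (0 : ℝ) 1) :
    ∃ c > 0, AntitoneOn (fun x => φ x / x ^ 2 + c * x) (Icc ξ 1) := by
  have hsub : Icc ξ 1 ⊆ Ioc (0 : ℝ) 1 := fun x hx => ⟨hξ.1.trans_le hx.1, hx.2⟩
  set q : ℝ → ℝ := fun x => (derivWithin φ (Ioc 0 1) x * x - 2 * φ x) / x ^ 3 with hq
  have hq_cont : ContinuousOn q (Icc ξ 1) := by
    have h1 : ContinuousOn (derivWithin φ (Ioc 0 1)) (Icc ξ 1) :=
      (h.contDiffOn_phi.continuousOn_derivWithin (uniqueDiffOn_Ioc 0 1) (by norm_num)).mono hsub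
    have h2 : ContinuousOn φ (Icc ξ 1) := h.contDiffOn_phi.continuousOn.mono hsub
    exact ((h1.mul continuousOn_id).sub (h2.const_smul (2 : ℝ))).div (by fun_prop)
      (fun x hx => pow_ne_zero _ (hsub hx).1.ne')
  have hder : ∀ x ∈ Ioo (0 : ℝ) 1, HasDerivAt φ (derivWithin φ (Ioc 0 1) x) x := fun x hx =>
    (hasDerivAt_of_contDiffOn h.contDiffOn_phi le_rfl hx).1
  have hneg : ∀ x ∈ Icc ξ 1, q x < 0 := by
    intro x hx
    have hx0 := (hsub hx).1
    refine div_neg_of_neg_of_pos ?_ (by positivity)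
    rcases hx.2.eq_or_lt with rfl | hx1
    · linarith [h.phi_one, h.deriv_phi_neg]
    · have := h.concaveOn_phi.le_slope_of_hasDerivAt (x := 0) (by simp) ⟨hx0.le, hx1.le⟩ hx0
        (hder x ⟨hx0, hx1⟩)
      rw [slope_def_field, h.phi_zero, sub_zero, sub_zero, le_div_iff₀ hx0] at this
      linarith [h.phi_pos ⟨hx0, hx1⟩]
  obtain ⟨x₀, hx₀, hmax⟩ := isCompact_Icc.exists_isMaxOn ⟨ξ, left_mem_Icc.2 hξ.2⟩ hq_cont
  refine ⟨-q x₀, by linarith [hneg x₀ hx₀], ?_⟩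
  have hd : ∀ x ∈ Ioo ξ 1, HasDerivAt (fun x => φ x / x ^ 2 + -q x₀ * x) (q x - q x₀) x := by
    intro x hx
    have hx0 : 0 < x := hξ.1.trans hx.1
    have := ((hder x ⟨hx0, hx.2⟩).div (hasDerivAt_pow 2 x) (by positivity)).add
      ((hasDerivAt_id x).const_mul (-q x₀))
    refine this.congr_deriv ?_
    simp only [hq]
    field_simp
    push_cast
    ring
  refine antitoneOn_of_deriv_nonpos (convex_Icc ξ 1) ?_ ?_ ?_
  · exact ((h.contDiffOn_phi.continuousOn.mono hsub).div (by fun_prop)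
      (fun x hx => pow_ne_zero _ (hsub hx).1.ne')).add (by fun_prop)
  · intro x hx
    rw [interior_Icc] at hx
    exact (hd x hx).differentiableAt.differentiableWithinAt
  · intro x hx
    have hx' := interior_subset hx
    rw [interior_Icc] at hx
    rw [(hd x hx).deriv]
    linarith [isMaxOn_iff.1 hmax x hx']

lemma IsCoefficientPair.exists_psi_div_sq_le (h : IsCoefficientPair φ ψ) {ξ : ℝ} (hξ : 0 < ξ) :
    ∃ C : ℝ, 0 ≤ C ∧ ∀ x ∈ Icc ξ 1, ∀ y ∈ Icc ξ 1, x ≤ y →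
      ψ x / x ^ 2 - ψ y / y ^ 2 ≤ C * (y - x) := by
  have hc : ContDiffOn ℝ 2 (fun x => ψ x / x ^ 2) (Ioc 0 1) :=
    h.contDiffOn_psi.div (by fun_prop) fun x hx => pow_ne_zero _ hx.1.ne'
  obtain ⟨K, hK⟩ := exists_lipschitzOnWith_Icc hc hξ
  refine ⟨K, K.2, fun x hx y hy hxy => ?_⟩
  have := hK.dist_le_mul x hx y hy
  rw [Real.dist_eq, Real.dist_eq, abs_sub_comm x y, abs_of_nonneg (by linarith : 0 ≤ y - x)] at this
  exact (le_abs_self _).trans this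

end Coefficients

/-! ### Characteristics -/

section Calculus

variable {f f' : ℝ → ℝ} {a b : ℝ}

lemma monotoneOn_Icc_of_hasDerivWithinAt
    (hf : ∀ r ∈ Icc a b, HasDerivWithinAt f (f' r) (Icc a b) r)
    (h0 : ∀ r ∈ Icc a b, 0 ≤ f' r) : MonotoneOn f (Icc a b) :=
  monotoneOn_of_hasDerivWithinAt_nonneg (f' := f') (convex_Icc a b)
    (fun r hr => (hf r hr).continuousWithinAt)
    (fun r hr => (hf r (interior_subset hr)).mono interior_subset)
    (fun r hr => h0 r (interior_subset hr))

lemma hasDerivWithinAt_Ici_of_Icc {c : ℝ} {r : ℝ} (hf : HasDerivWithinAt f c (Icc a b) r)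
    (hr : r ∈ Ico a b) : HasDerivWithinAt f c (Ici r) r :=
  hf.mono_of_mem_nhdsWithin (Icc_mem_nhdsGE_of_mem hr)

lemma hasDerivWithinAt_Iic_of_Icc {c : ℝ} {r : ℝ} (hf : HasDerivWithinAt f c (Icc a b) r)
    (hr : r ∈ Ioc a b) : HasDerivWithinAt f c (Iic r) r :=
  hf.mono_of_mem_nhdsWithin (Icc_mem_nhdsLE_of_mem hr)

end Calculus

section GlobalODE

variable {v : ℝ → ℝ → ℝ} {a b t₀ : ℝ} {K L : NNReal}

/-- A bounded, globally Lipschitz vector field has solutions on the whole time interval. -/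
lemma exists_solution_of_lipschitzWith (hv : ∀ r ∈ Icc a b, LipschitzWith K (v r))
    (hc : ∀ x, ContinuousOn (fun r => v r x) (Icc a b))
    (hb : ∀ r ∈ Icc a b, ∀ x, ‖v r x‖ ≤ L) (ht₀ : t₀ ∈ Icc a b) (x₀ : ℝ) :
    ∃ X : ℝ → ℝ, X t₀ = x₀ ∧
      ∀ r ∈ Icc a b, HasDerivWithinAt X (v r (X r)) (Icc a b) r := by
  have hab : 0 ≤ b - a := by linarith [ht₀.1, ht₀.2]
  have hPL : IsPicardLindelof v (⟨t₀, ht₀⟩ : Icc a b) x₀ (L * ⟨b - a, hab⟩) 0 L K :=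
    { lipschitzOnWith := fun r hr => (hv r hr).lipschitzOnWith
      continuousOn := fun x _ => hc x
      norm_le := fun r hr x _ => hb r hr x
      mul_max_le := by
        push_cast
        rw [sub_zero]
        refine mul_le_mul_of_nonneg_left (max_le ?_ ?_) L.2
        · show b - t₀ ≤ b - a
          linarith [ht₀.1]
        · show t₀ - a ≤ b - a
          linarith [ht₀.2] }
  exact hPL.exists_eq_forall_mem_Icc_hasDerivWithinAt₀

lemma eqOn_of_solutions (hv : ∀ r ∈ Icc a b, LipschitzWith K (v r)) {X Y : ℝ → ℝ}
    (hX : ∀ r ∈ Icc a b, HasDerivWithinAt X (v r (X r)) (Icc a b) r)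
    (hY : ∀ r ∈ Icc a b, HasDerivWithinAt Y (v r (Y r)) (Icc a b) r)
    (ht₀ : t₀ ∈ Icc a b) (h : X t₀ = Y t₀) : EqOn X Y (Icc a b) := by
  have hXc : ContinuousOn X (Icc a b) := fun r hr => (hX r hr).continuousWithinAt
  have hYc : ContinuousOn Y (Icc a b) := fun r hr => (hY r hr).continuousWithinAt
  intro r hr
  rcases le_total r t₀ with hle | hle
  · have hs : Icc a t₀ ⊆ Icc a b := Icc_subset_Icc_right ht₀.2
    exact ODE_solution_unique_of_mem_Icc_left (v := v) (s := fun _ => univ) (K := K)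
      (fun s hs' => (hv s (hs ⟨hs'.1.le, hs'.2⟩)).lipschitzOnWith) (hXc.mono hs)
      (fun s hs' => hasDerivWithinAt_Iic_of_Icc (hX s (hs ⟨hs'.1.le, hs'.2⟩))
        ⟨hs'.1, hs'.2.trans ht₀.2⟩) (fun _ _ => mem_univ _) (hYc.mono hs)
      (fun s hs' => hasDerivWithinAt_Iic_of_Icc (hY s (hs ⟨hs'.1.le, hs'.2⟩))
        ⟨hs'.1, hs'.2.trans ht₀.2⟩) (fun _ _ => mem_univ _) h ⟨hr.1, hle⟩
  · have hs : Icc t₀ b ⊆ Icc a b := Icc_subset_Icc_left ht₀.1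
    exact ODE_solution_unique_of_mem_Icc_right (v := v) (s := fun _ => univ) (K := K)
      (fun s hs' => (hv s (hs ⟨hs'.1, hs'.2.le⟩)).lipschitzOnWith) (hXc.mono hs)
      (fun s hs' => hasDerivWithinAt_Ici_of_Icc (hX s (hs ⟨hs'.1, hs'.2.le⟩))
        ⟨ht₀.1.trans hs'.1, hs'.2⟩) (fun _ _ => mem_univ _) (hYc.mono hs)
      (fun s hs' => hasDerivWithinAt_Ici_of_Icc (hY s (hs ⟨hs'.1, hs'.2.le⟩))
        ⟨ht₀.1.trans hs'.1, hs'.2⟩) (fun _ _ => mem_univ _) h ⟨hle, hr.2⟩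

/-- Solutions of a scalar equation do not cross. -/
lemma lt_of_solutions (hv : ∀ r ∈ Icc a b, LipschitzWith K (v r)) {X Y : ℝ → ℝ}
    (hX : ∀ r ∈ Icc a b, HasDerivWithinAt X (v r (X r)) (Icc a b) r)
    (hY : ∀ r ∈ Icc a b, HasDerivWithinAt Y (v r (Y r)) (Icc a b) r)
    (ht₀ : t₀ ∈ Icc a b) (h : X t₀ < Y t₀) : ∀ r ∈ Icc a b, X r < Y r := by
  intro r hr
  by_contra hlt
  rw [not_lt] at hlt
  have hc : ContinuousOn (fun s => Y s - X s) (Icc a b) := fun s hs =>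
    (hY s hs).continuousWithinAt.sub (hX s hs).continuousWithinAt
  have hsub : uIcc r t₀ ⊆ Icc a b := uIcc_subset_Icc hr ht₀
  obtain ⟨s, hs, hs0⟩ : (0 : ℝ) ∈ (fun s => Y s - X s) '' uIcc r t₀ := by
    apply intermediate_value_uIcc (hc.mono hsub)
    rw [mem_uIcc]
    left
    constructor <;> linarith
  have := eqOn_of_solutions hv hX hY (hsub hs) (by simp only at hs0; linarith) ht₀
  linarith

end GlobalODE

section Clamp

variable {φ ψ κ : ℝ → ℝ} {a b ξ : ℝ}

/-- The point of `[ξ, 1]` closest to `x` (for `ξ ≤ 1`). -/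
noncomputable def clamp (ξ x : ℝ) : ℝ := max ξ (min x 1)

lemma clamp_mem (hξ : ξ ≤ 1) (x : ℝ) : clamp ξ x ∈ Icc ξ 1 :=
  ⟨le_max_left _ _, max_le hξ (min_le_right _ _)⟩

lemma clamp_of_mem {x : ℝ} (hx : x ∈ Icc ξ 1) : clamp ξ x = x := by
  rw [clamp, min_eq_left hx.2, max_eq_right hx.1]

lemma abs_clamp_sub_le (ξ x y : ℝ) : |clamp ξ x - clamp ξ y| ≤ |x - y| := by
  rw [clamp, clamp, max_comm ξ, max_comm ξ]
  exact (abs_max_sub_max_le_abs _ _ _).trans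
    ((abs_min_sub_min_le_max x 1 y 1).trans (by simp))

/-- The characteristic vector field `φ - κ ψ`, frozen to the left of `ξ` and to the right of `1`.
It is globally Lipschitz, while `φ` need not be Lipschitz at `0`. -/
noncomputable def clampedField (φ ψ κ : ℝ → ℝ) (ξ r x : ℝ) : ℝ :=
  φ (clamp ξ x) - κ r * ψ (clamp ξ x)

lemma exists_lipschitzWith_clampedField (h : IsCoefficientPair φ ψ) (hκ : ContinuousOn κ (Icc a b))
    (hξ : ξ ∈ Ioo (0 : ℝ) 1) :
    ∃ K : NNReal, ∀ r ∈ Icc a b, LipschitzWith K (clampedField φ ψ κ ξ r) := by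
  obtain ⟨K₁, hK₁⟩ := exists_lipschitzOnWith_Icc h.contDiffOn_phi hξ.1
  obtain ⟨K₂, hK₂⟩ := exists_lipschitzOnWith_Icc h.contDiffOn_psi hξ.1
  obtain ⟨B, hB⟩ := isCompact_Icc.exists_bound_of_continuousOn hκ
  refine ⟨K₁ + B.toNNReal * K₂, fun r hr => LipschitzWith.of_dist_le_mul fun x y => ?_⟩
  have h₁ := hK₁.dist_le_mul _ (clamp_mem hξ.2.le x) _ (clamp_mem hξ.2.le y)
  have h₂ := hK₂.dist_le_mul _ (clamp_mem hξ.2.le x) _ (clamp_mem hξ.2.le y)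
  rw [Real.dist_eq, Real.dist_eq] at h₁ h₂
  have hκr : |κ r| ≤ (B.toNNReal : ℝ) := (hB r hr).trans (Real.le_coe_toNNReal B)
  have hxy := abs_clamp_sub_le ξ x y
  rw [Real.dist_eq, Real.dist_eq]
  push_cast
  calc |clampedField φ ψ κ ξ r x - clampedField φ ψ κ ξ r y|
      = |(φ (clamp ξ x) - φ (clamp ξ y)) - κ r * (ψ (clamp ξ x) - ψ (clamp ξ y))| := by
        simp only [clampedField]; ring_nf
    _ ≤ |φ (clamp ξ x) - φ (clamp ξ y)| + |κ r| * |ψ (clamp ξ x) - ψ (clamp ξ y)| := by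
        rw [← abs_mul]; exact abs_sub _ _
    _ ≤ K₁ * |x - y| + B.toNNReal * (K₂ * |x - y|) := by
        refine add_le_add (h₁.trans (by gcongr)) (mul_le_mul hκr (h₂.trans (by gcongr))
          (abs_nonneg _) (NNReal.coe_nonneg _))
    _ = _ := by ring

lemma clampedField_one (h : IsCoefficientPair φ ψ) (hξ : ξ ≤ 1) (r : ℝ) :
    clampedField φ ψ κ ξ r 1 = 0 := by
  simp [clampedField, clamp_of_mem (right_mem_Icc.2 hξ), h.phi_one, h.psi_one]

lemma exists_clamped_solution (h : IsCoefficientPair φ ψ) (hκ : ContinuousOn κ (Icc a b))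
    (hξ : ξ ∈ Ioo (0 : ℝ) 1) {t₀ x₀ : ℝ} (ht₀ : t₀ ∈ Icc a b) (hx₀ : x₀ < 1) :
    ∃ X : ℝ → ℝ, X t₀ = x₀ ∧ (∀ r ∈ Icc a b, X r < 1) ∧
      ∀ r ∈ Icc a b, HasDerivWithinAt X (clampedField φ ψ κ ξ r (X r)) (Icc a b) r := by
  obtain ⟨K, hK⟩ := exists_lipschitzWith_clampedField h hκ hξ
  obtain ⟨B, hB⟩ := isCompact_Icc.exists_bound_of_continuousOn hκ
  obtain ⟨M₁, hM₁⟩ := isCompact_Icc.exists_bound_of_continuousOn h.continuousOn_phi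
  obtain ⟨M₂, hM₂⟩ := isCompact_Icc.exists_bound_of_continuousOn h.continuousOn_psi
  have hcl : ∀ x, clamp ξ x ∈ Icc (0 : ℝ) 1 := fun x =>
    Icc_subset_Icc_left hξ.1.le (clamp_mem hξ.2.le x)
  obtain ⟨X, hX0, hX⟩ := exists_solution_of_lipschitzWith (v := clampedField φ ψ κ ξ) (K := K)
    (L := (M₁ + B * M₂).toNNReal) hK
    (fun x => continuousOn_const.sub (hκ.mul continuousOn_const)) (fun r hr x => by
      refine le_trans ?_ (Real.le_coe_toNNReal _)
      refine (norm_sub_le _ _).trans (add_le_add (hM₁ _ (hcl x)) ?_)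
      rw [norm_mul]
      exact mul_le_mul (hB r hr) (hM₂ _ (hcl x)) (norm_nonneg _) ((norm_nonneg _).trans (hB r hr)))
    ht₀ x₀
  refine ⟨X, hX0, ?_, hX⟩
  refine lt_of_solutions (Y := fun _ => 1) hK hX (fun r _ => ?_) ht₀ (by simpa [hX0] using hx₀)
  rw [clampedField_one h hξ.2.le]
  exact hasDerivWithinAt_const _ _ _

lemma isCharacteristic_of_clamped (hξ : ξ ∈ Ioo (0 : ℝ) 1) {X : ℝ → ℝ}
    (hX1 : ∀ r ∈ Icc a b, X r < 1) (hXξ : ∀ r ∈ Icc a b, ξ ≤ X r)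
    (hX : ∀ r ∈ Icc a b, HasDerivWithinAt X (clampedField φ ψ κ ξ r (X r)) (Icc a b) r) :
    IsCharacteristic φ ψ κ a b X := by
  intro r hr
  refine ⟨⟨hξ.1.le.trans (hXξ r hr), hX1 r hr⟩, ?_⟩
  have := hX r hr
  rwa [clampedField, clamp_of_mem ⟨hXξ r hr, (hX1 r hr).le⟩] at this

/-- For `κ > 0` the field `φ - κ ψ` is negative near `0`, so every characteristic that is in `(0,1)`
at the final time can be followed back. -/
lemma exists_backward_characteristic (h : IsCoefficientPair φ ψ) (hκ : ContinuousOn κ (Icc a b))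
    (hpos : ∀ r ∈ Icc a b, 0 < κ r) (hab : a ≤ b) {x : ℝ} (hx : x ∈ Ioo (0 : ℝ) 1) :
    ∃ X : ℝ → ℝ, IsCharacteristic φ ψ κ a b X ∧ X b = x ∧ ∀ r ∈ Icc a b, 0 < X r := by
  obtain ⟨r₀, hr₀, hmin⟩ := isCompact_Icc.exists_isMinOn ⟨a, left_mem_Icc.2 hab⟩ hκ
  obtain ⟨ξ, ⟨hξ0, hξx⟩, hξ⟩ : ∃ ξ, ξ ∈ Ioo 0 x ∧ φ ξ - κ r₀ * ψ ξ < 0 := by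
    have hc : ContinuousWithinAt (fun y => φ y - κ r₀ * ψ y) (Ioi 0) 0 := by
      have h0 : (0 : ℝ) ∈ Icc (0 : ℝ) 1 := by simp
      have := (h.continuousOn_phi 0 h0).sub
        (continuousWithinAt_const.mul (h.continuousOn_psi 0 h0) (f := fun _ => κ r₀))
      exact this.mono_of_mem_nhdsWithin (mem_of_superset (Ioo_mem_nhdsGT one_pos)
        Ioo_subset_Icc_self)
    have hlt : φ 0 - κ r₀ * ψ 0 < 0 := by
      rw [h.phi_zero]
      linarith [mul_pos (hpos r₀ hr₀) (h.psi_pos (x := 0) (by simp))]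
    have h1 : ∀ᶠ y in 𝓝[>] (0 : ℝ), φ y - κ r₀ * ψ y < 0 := hc.eventually (gt_mem_nhds hlt)
    have h2 : ∀ᶠ y in 𝓝[>] (0 : ℝ), y ∈ Ioo 0 x := Ioo_mem_nhdsGT hx.1
    exact (h2.and h1).exists
  have hξ' : ξ ∈ Ioo (0 : ℝ) 1 := ⟨hξ0, hξx.trans hx.2⟩
  obtain ⟨X, hXb, hX1, hX⟩ := exists_clamped_solution h hκ hξ' (right_mem_Icc.2 hab) hx.2
  have hXξ : ∀ r ∈ Icc a b, ξ ≤ X r := by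
    intro r hr
    by_contra hlt
    rw [not_le] at hlt
    have hsub : Icc r b ⊆ Icc a b := Icc_subset_Icc_left hr.1
    have := image_le_of_deriv_right_lt_deriv_boundary (f := X) (a := r) (b := b)
      (f' := fun s => clampedField φ ψ κ ξ s (X s)) (B := fun _ => ξ) (B' := fun _ => 0)
      (fun s hs => ((hX s (hsub hs)).mono hsub).continuousWithinAt)
      (fun s hs => hasDerivWithinAt_Ici_of_Icc (hX s (hsub (Ico_subset_Icc_self hs)))
        ⟨hr.1.trans hs.1, hs.2⟩) hlt.le (fun s => hasDerivAt_const _ _) (fun s hs he => by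
        have hs' := hsub (Ico_subset_Icc_self hs)
        simp only [he, clampedField, clamp_of_mem (left_mem_Icc.2 hξ'.2.le)]
        have := mul_le_mul_of_nonneg_right (isMinOn_iff.1 hmin s hs')
          (h.psi_nonneg (Ioo_subset_Icc_self hξ'))
        linarith) (right_mem_Icc.2 hr.2)
    simp only [hXb] at this
    linarith
  exact ⟨X, isCharacteristic_of_clamped hξ' hX1 hXξ hX, hXb,
    fun r hr => hξ0.trans_le (hXξ r hr)⟩

/-- If `κ ≤ δ`, then characteristics move to the left with speed at most `δ ψ(0)`. -/
lemma exists_forward_characteristic (h : IsCoefficientPair φ ψ) (hκ : ContinuousOn κ (Icc a b))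
    {δ : ℝ} (hδ : 0 ≤ δ) (hle : ∀ r ∈ Icc a b, κ r ≤ δ) (hab : a ≤ b) {y : ℝ}
    (hy : 0 < y) (hy1 : y + δ * ψ 0 * (b - a) < 1) :
    ∃ X : ℝ → ℝ, IsCharacteristic φ ψ κ a b X ∧ X a = y + δ * ψ 0 * (b - a) ∧ y ≤ X b := by
  have hψ0 : 0 < ψ 0 := h.psi_pos (by simp)
  have hd : 0 ≤ δ * ψ 0 * (b - a) := mul_nonneg (mul_nonneg hδ hψ0.le) (by linarith)
  have hy' : y ∈ Ioo (0 : ℝ) 1 := ⟨hy, by linarith⟩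
  obtain ⟨X, hXa, hX1, hX⟩ := exists_clamped_solution h hκ hy' (left_mem_Icc.2 hab) hy1
  have hmono : MonotoneOn (fun r => X r + δ * ψ 0 * r) (Icc a b) := by
    refine monotoneOn_Icc_of_hasDerivWithinAt
      (f' := fun r => clampedField φ ψ κ y r (X r) + δ * ψ 0) (fun r hr => ?_) (fun r hr => ?_)
    · have h1 : HasDerivWithinAt (fun r => δ * ψ 0 * r) (δ * ψ 0) (Icc a b) r := by
        simpa using ((hasDerivAt_id r).const_mul (δ * ψ 0)).hasDerivWithinAt (s := Icc a b)
      exact (hX r hr).add h1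
    · have hc : clamp y (X r) ∈ Icc (0 : ℝ) 1 :=
        Icc_subset_Icc_left hy.le (clamp_mem hy'.2.le _)
      have h1 := h.phi_nonneg hc
      have h2 := mul_le_mul_of_nonneg_right (hle r hr) (h.psi_nonneg hc)
      have h3 := mul_le_mul_of_nonneg_left (h.psi_le hc) hδ
      simp only [clampedField]
      linarith
  have hXy : ∀ r ∈ Icc a b, y ≤ X r := by
    intro r hr
    have := hmono (left_mem_Icc.2 hab) hr hr.1
    simp only [hXa] at this
    nlinarith [mul_nonneg (mul_nonneg hδ hψ0.le) (by linarith [hr.2] : 0 ≤ b - r)]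
  exact ⟨X, isCharacteristic_of_clamped hy' hX1 hXy hX, hXa, hXy b (right_mem_Icc.2 hab)⟩

lemma IsCharacteristic.mono {X : ℝ → ℝ} (hX : IsCharacteristic φ ψ κ a b X) {a' b' : ℝ}
    (ha : a ≤ a') (hb : b' ≤ b) : IsCharacteristic φ ψ κ a' b' X := fun s hs =>
  have hs' : s ∈ Icc a b := ⟨ha.trans hs.1, hs.2.trans hb⟩
  ⟨(hX s hs').1, (hX s hs').2.mono (Icc_subset_Icc ha hb)⟩

lemma IsCharacteristic.continuousOn {X : ℝ → ℝ} (hX : IsCharacteristic φ ψ κ a b X) :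
    ContinuousOn X (Icc a b) := fun s hs => (hX s hs).2.continuousWithinAt

lemma IsCharacteristic.lt (h : IsCoefficientPair φ ψ) (hκ : ContinuousOn κ (Icc a b))
    {X Y : ℝ → ℝ} (hX : IsCharacteristic φ ψ κ a b X) (hY : IsCharacteristic φ ψ κ a b Y)
    (hX0 : ∀ r ∈ Icc a b, 0 < X r) (hY0 : ∀ r ∈ Icc a b, 0 < Y r) (hab : a ≤ b)
    (hlt : X b < Y b) : ∀ r ∈ Icc a b, X r < Y r := by
  obtain ⟨r₁, hr₁, h₁⟩ := isCompact_Icc.exists_isMinOn ⟨a, left_mem_Icc.2 hab⟩ hX.continuousOn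
  obtain ⟨r₂, hr₂, h₂⟩ := isCompact_Icc.exists_isMinOn ⟨a, left_mem_Icc.2 hab⟩ hY.continuousOn
  set ξ := min (X r₁) (Y r₂) with hξ
  have hξ0 : ξ ∈ Ioo (0 : ℝ) 1 :=
    ⟨lt_min (hX0 _ hr₁) (hY0 _ hr₂), (min_le_left _ _).trans_lt (hX _ hr₁).1.2⟩
  obtain ⟨K, hK⟩ := exists_lipschitzWith_clampedField h hκ hξ0
  refine lt_of_solutions hK (fun r hr => ?_) (fun r hr => ?_) (right_mem_Icc.2 hab) hlt
  · rw [clampedField, clamp_of_mem ⟨(min_le_left _ _).trans (isMinOn_iff.1 h₁ r hr),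
      (hX r hr).1.2.le⟩]
    exact (hX r hr).2
  · rw [clampedField, clamp_of_mem ⟨(min_le_right _ _).trans (isMinOn_iff.1 h₂ r hr),
      (hY r hr).1.2.le⟩]
    exact (hY r hr).2

end Clamp

section Solutions

variable {φ ψ c₀ κ : ℝ → ℝ} {w : ℝ → ℝ → ℝ}

/-- The transport equation integrated along a characteristic. -/
lemma IsSolution.eq_exp_mul (hs : IsSolution φ ψ c₀ w κ) {a b : ℝ} (ha : 0 ≤ a) (hab : a ≤ b)
    {X : ℝ → ℝ} (hX : IsCharacteristic φ ψ κ a b X) :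
    w (X b) b = Real.exp (b - a) * w (X a) a := by
  rcases hab.eq_or_lt with rfl | hlt
  · simp
  have hd : ∀ r ∈ Icc a b,
      HasDerivWithinAt (fun r => Real.exp (-r) * w (X r) r) 0 (Icc a b) r := by
    intro r hr
    have h1 : HasDerivWithinAt (fun r => Real.exp (-r)) (-Real.exp (-r)) (Icc a b) r := by
      simpa using ((hasDerivAt_neg r).exp).hasDerivWithinAt
    refine (h1.mul (hs.transport a b ha hlt X hX r hr)).congr_deriv ?_
    ring
  have h1 := monotoneOn_Icc_of_hasDerivWithinAt hd (fun _ _ => le_rfl)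
    (left_mem_Icc.2 hab) (right_mem_Icc.2 hab) hab
  have h2 := monotoneOn_Icc_of_hasDerivWithinAt (f' := fun _ => -0) (fun r hr => (hd r hr).neg)
    (fun _ _ => by simp) (left_mem_Icc.2 hab) (right_mem_Icc.2 hab) hab
  have h3 : Real.exp (-b) * w (X b) b = Real.exp (-a) * w (X a) a :=
    le_antisymm (by simpa using h2) h1
  rw [sub_eq_add_neg, Real.exp_add, mul_assoc, ← h3, ← mul_assoc, ← Real.exp_add]
  simp

end Solutions

/-! ### Conservation of mass -/

section Mass

variable {φ ψ c₀ κ : ℝ → ℝ} {w : ℝ → ℝ → ℝ} {t : ℝ}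

lemma IsSolution.intervalIntegrable (hs : IsSolution φ ψ c₀ w κ) (ht : 0 ≤ t) {a b : ℝ}
    (ha : a ∈ Icc (0 : ℝ) 1) (hb : b ∈ Icc (0 : ℝ) 1) :
    IntervalIntegrable (fun x => w x t) volume a b := by
  have h : IntervalIntegrable (fun x => w x t) volume 0 1 := by
    by_contra hn
    have := hs.mass t ht
    rw [intervalIntegral.integral_undef hn] at this
    norm_num at this
  refine h.mono_set ?_
  rw [uIcc_of_le (zero_le_one' ℝ)]
  exact uIcc_subset_Icc ha hb

lemma IsSolution.integral_add (hs : IsSolution φ ψ c₀ w κ) (ht : 0 ≤ t) {a : ℝ}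
    (ha : a ∈ Icc (0 : ℝ) 1) : (∫ x in (0 : ℝ)..a, w x t) + ∫ x in a..1, w x t = 1 := by
  rw [intervalIntegral.integral_add_adjacent_intervals (hs.intervalIntegrable ht (by simp) ha)
    (hs.intervalIntegrable ht ha (by simp)), hs.mass t ht]

lemma IsSolution.one_sub_le_integral (hs : IsSolution φ ψ c₀ w κ) (ht : 0 ≤ t) {a N : ℝ}
    (ha : a ∈ Icc (0 : ℝ) 1) (hN : ∀ x ∈ Ioo (0 : ℝ) 1, w x t ≤ N) :
    1 - a * N ≤ ∫ x in a..1, w x t := by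
  have h : ∫ x in (0 : ℝ)..a, w x t ≤ ∫ x in (0 : ℝ)..a, N :=
    intervalIntegral.integral_mono_on_of_le_Ioo ha.1 (hs.intervalIntegrable ht (by simp) ha)
      intervalIntegrable_const fun x hx => hN x ⟨hx.1, hx.2.trans_le ha.2⟩
  rw [intervalIntegral.integral_const, smul_eq_mul, sub_zero] at h
  linarith [hs.integral_add ht ha]

lemma IsSolution.integral_le_one_sub (hs : IsSolution φ ψ c₀ w κ) (ht : 0 ≤ t) {a x : ℝ}
    (ha : 0 ≤ a) (hax : a ≤ x) (hx : x ∈ Ioo (0 : ℝ) 1) :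
    ∫ y in a..1, w y t ≤ 1 - a * w x t := by
  have ha' : a ∈ Icc (0 : ℝ) 1 := ⟨ha, hax.trans hx.2.le⟩
  have h : ∫ y in (0 : ℝ)..a, w x t ≤ ∫ y in (0 : ℝ)..a, w y t :=
    intervalIntegral.integral_mono_on_of_le_Ioo ha intervalIntegrable_const
      (hs.intervalIntegrable ht (by simp) ha') fun y hy =>
        hs.antitone t ht ⟨hy.1.le, hy.2.trans_le ha'.2⟩ ⟨hx.1.le, hx.2⟩ (hy.2.le.trans hax)
  rw [intervalIntegral.integral_const, smul_eq_mul, sub_zero] at h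
  linarith [hs.integral_add ht ha']

lemma IsSolution.mul_le_one (hs : IsSolution φ ψ c₀ w κ) (ht : 0 ≤ t) {x : ℝ}
    (hx : x ∈ Ioo (0 : ℝ) 1) : x * w x t ≤ 1 := by
  have h1 := hs.integral_le_one_sub ht hx.1.le le_rfl hx
  have h2 : 0 ≤ ∫ y in x..1, w y t := by
    have : ∫ y in x..1, (0 : ℝ) ≤ ∫ y in x..1, w y t :=
      intervalIntegral.integral_mono_on_of_le_Ioo hx.2.le intervalIntegrable_const
        (hs.intervalIntegrable ht ⟨hx.1.le, hx.2.le⟩ (by simp)) fun y hy =>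
          hs.nonneg t ht y ⟨hx.1.le.trans hy.1.le, hy.2⟩
    simpa using this
  linarith

/-- In time `ε` the mass grows by the factor `exp ε`, and at most `δ ψ(0) N ε` of it is lost through
`0`; let `ε → 0`. -/
lemma IsSolution.one_le_mul_of_lt (h : IsCoefficientPair φ ψ) (hs : IsSolution φ ψ c₀ w κ)
    (ht : 0 ≤ t) {N δ : ℝ} (hN : ∀ x ∈ Ioo (0 : ℝ) 1, w x t ≤ N) (hδ : 0 < δ) (hκ : κ t < δ) :
    1 ≤ δ * ψ 0 * N := by
  have hψ0 : 0 < ψ 0 := h.psi_pos (by simp)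
  have hP : 0 < δ * ψ 0 := mul_pos hδ hψ0
  have hcont : ContinuousWithinAt κ (Ici t) t :=
    (hs.continuousOn_kappa t ht).mono (Ici_subset_Ici.2 ht)
  obtain ⟨ε₀, hε₀, hκ'⟩ : ∃ ε₀ > 0, ∀ r ∈ Icc t (t + ε₀), κ r ≤ δ := by
    have hev : ∀ᶠ r in 𝓝[≥] t, κ r < δ := hcont.eventually (gt_mem_nhds hκ)
    obtain ⟨u, hu, hsub⟩ := mem_nhdsGE_iff_exists_Icc_subset.1 hev
    exact ⟨u - t, sub_pos.2 hu, fun r hr => (hsub ⟨hr.1, by linarith [hr.2]⟩ : κ r < δ).le⟩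
  have key : ∀ ε ∈ Ioo 0 (min ε₀ (δ * ψ 0)⁻¹), 1 ≤ δ * ψ 0 * N * (1 + ε) := by
    intro ε hε
    have hε1 : ε ≤ ε₀ := hε.2.le.trans (min_le_left _ _)
    set d := δ * ψ 0 * ε with hd
    have hd0 : 0 < d := mul_pos hP hε.1
    have hd1 : d < 1 := by
      have := mul_lt_mul_of_pos_left (hε.2.trans_le (min_le_right _ _)) hP
      rwa [mul_inv_cancel₀ hP.ne'] at this
    have htε : 0 ≤ t + ε := by linarith [hε.1]
    have hpt : ∀ y ∈ Ioo 0 (1 - d), Real.exp ε * w (y + d) t ≤ w y (t + ε) := by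
      intro y hy
      have he : δ * ψ 0 * (t + ε - t) = d := by rw [hd]; ring
      obtain ⟨X, hX, hXt, hXy⟩ := exists_forward_characteristic h (a := t) (b := t + ε)
        (hs.continuousOn_kappa.mono fun r hr => ht.trans hr.1) hδ.le
        (fun r hr => hκ' r ⟨hr.1, by linarith [hr.2]⟩) (by linarith [hε.1]) hy.1
        (by rw [he]; linarith [hy.2])
      rw [he] at hXt
      have := hs.eq_exp_mul ht (by linarith [hε.1]) hX
      rw [hXt, add_sub_cancel_left] at this
      rw [← this]
      exact hs.antitone (t + ε) htε ⟨hy.1.le, by linarith [hy.2]⟩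
        (hX (t + ε) ⟨by linarith [hε.1], le_rfl⟩).1 hXy
    have hd01 : d ∈ Icc (0 : ℝ) 1 := ⟨hd0.le, hd1.le⟩
    have h1d : 1 - d ∈ Icc (0 : ℝ) 1 := ⟨by linarith, by linarith⟩
    have hint : IntervalIntegrable (fun y => w (y + d) t) volume 0 (1 - d) := by
      have := (hs.intervalIntegrable ht hd01 (by simp : (1 : ℝ) ∈ Icc (0 : ℝ) 1)).comp_add_right d
      simpa using this
    have hi1 : ∫ y in (0 : ℝ)..(1 - d), Real.exp ε * w (y + d) t
        ≤ ∫ y in (0 : ℝ)..(1 - d), w y (t + ε) :=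
      intervalIntegral.integral_mono_on_of_le_Ioo h1d.1 (hint.const_mul _)
        (hs.intervalIntegrable htε (by simp) h1d) hpt
    have hi2 : ∫ y in (0 : ℝ)..(1 - d), w y (t + ε) ≤ 1 := by
      have h0 : ∫ y in (1 - d)..1, (0 : ℝ) ≤ ∫ y in (1 - d)..1, w y (t + ε) :=
        intervalIntegral.integral_mono_on_of_le_Ioo h1d.2 intervalIntegrable_const
          (hs.intervalIntegrable htε h1d (by simp)) fun y hy =>
            hs.nonneg _ htε y ⟨h1d.1.trans hy.1.le, hy.2⟩
      simp only [intervalIntegral.integral_zero] at h0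
      linarith [hs.integral_add htε h1d]
    rw [intervalIntegral.integral_const_mul,
      intervalIntegral.integral_comp_add_right (fun y => w y t), zero_add, sub_add_cancel] at hi1
    have hm := hs.one_sub_le_integral ht hd01 hN
    have hexp : 1 + ε ≤ Real.exp ε := by linarith [Real.add_one_le_exp ε]
    by_contra hcon
    rw [not_le] at hcon
    have h3 : ε * (δ * ψ 0 * N * (1 + ε)) < ε * 1 := mul_lt_mul_of_pos_left hcon hε.1
    have h4 : 1 < (1 + ε) * (1 - d * N) := by rw [hd]; nlinarith
    have h5 : 0 < 1 - d * N := by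
      by_contra h6
      nlinarith [hε.1]
    have h6 : (1 + ε) * (1 - d * N) ≤ Real.exp ε * ∫ y in d..1, w y t :=
      mul_le_mul hexp hm h5.le (Real.exp_pos _).le
    linarith
  have hlim : Tendsto (fun ε : ℝ => δ * ψ 0 * N * (1 + ε)) (𝓝[>] 0) (𝓝 (δ * ψ 0 * N)) := by
    have : Continuous fun ε : ℝ => δ * ψ 0 * N * (1 + ε) := by fun_prop
    simpa using (this.tendsto 0).mono_left nhdsWithin_le_nhds
  refine ge_of_tendsto hlim ?_
  have : Ioo 0 (min ε₀ (δ * ψ 0)⁻¹) ∈ 𝓝[>] (0 : ℝ) :=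
    Ioo_mem_nhdsGT (lt_min hε₀ (inv_pos.2 hP))
  filter_upwards [this] with ε hε using key ε hε

/-- Conservation of mass bounds `κ` from below by the reciprocal of `sup w`: the mass grows at
rate `1` and is lost only through `0`, where the speed is `κ ψ(0)`. -/
lemma IsSolution.one_le_kappa_mul (h : IsCoefficientPair φ ψ) (hs : IsSolution φ ψ c₀ w κ)
    (ht : 0 ≤ t) {N : ℝ} (hN : ∀ x ∈ Ioo (0 : ℝ) 1, w x t ≤ N) : 1 ≤ κ t * ψ 0 * N := by
  have hpos : 1 ≤ max (κ t) 0 * ψ 0 * N := by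
    have hlim : Tendsto (fun δ : ℝ => δ * ψ 0 * N) (𝓝[>] (max (κ t) 0))
        (𝓝 (max (κ t) 0 * ψ 0 * N)) := by
      have : Continuous fun δ : ℝ => δ * ψ 0 * N := by fun_prop
      exact (this.tendsto _).mono_left nhdsWithin_le_nhds
    refine ge_of_tendsto hlim ?_
    filter_upwards [self_mem_nhdsWithin] with δ hδ
    exact hs.one_le_mul_of_lt h ht hN ((le_max_right _ _).trans_lt hδ)
      ((le_max_left _ _).trans_lt hδ)
  rcases le_total (κ t) 0 with hle | hle
  · rw [max_eq_right hle] at hpos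
    norm_num at hpos
  · rwa [max_eq_left hle] at hpos

lemma IsSolution.kappa_pos (h : IsCoefficientPair φ ψ) (hs : IsSolution φ ψ c₀ w κ)
    (ht : 0 ≤ t) : 0 < κ t := by
  have hle : ∀ x ∈ Ioo (0 : ℝ) 1, w x t ≤ w 0 t := fun x hx =>
    hs.antitone t ht (by simp) ⟨hx.1.le, hx.2⟩ hx.1.le
  have h1 := hs.one_le_kappa_mul h ht hle
  have h0 : 0 ≤ ψ 0 * w 0 t := mul_nonneg (h.psi_pos (by simp)).le (hs.nonneg t ht 0 (by simp))
  by_contra hn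
  rw [not_lt] at hn
  nlinarith [mul_nonneg_of_nonpos_of_nonpos hn (neg_nonpos.2 h0)]

/-- A concave function that is continuous and vanishes at `0` lies below lines of arbitrarily small
intercept. -/
lemma IsCoefficientPair.exists_phi_le (h : IsCoefficientPair φ ψ) {δ : ℝ} (hδ : 0 < δ) :
    ∃ K : ℝ, 0 ≤ K ∧ ∀ x ∈ Icc (0 : ℝ) 1, φ x ≤ δ + K * x := by
  obtain ⟨M, hM⟩ := isCompact_Icc.exists_bound_of_continuousOn h.continuousOn_phi
  have hM0 : 0 ≤ M := (norm_nonneg _).trans (hM 0 (by simp))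
  have hev : ∀ᶠ y in 𝓝[Icc 0 1] (0 : ℝ), φ y < δ :=
    (h.continuousOn_phi 0 (by simp)).eventually (gt_mem_nhds (by rwa [h.phi_zero]))
  obtain ⟨η, hη, hsub⟩ := Metric.mem_nhdsWithin_iff.1 hev
  refine ⟨M / η, by positivity, fun x hx => ?_⟩
  by_cases hxη : x < η
  · have : φ x < δ := hsub ⟨by simpa [abs_of_nonneg hx.1] using hxη, hx⟩
    have h0 : 0 ≤ M / η * x := mul_nonneg (by positivity) hx.1
    linarith
  · rw [not_lt] at hxη
    have h1 : φ x ≤ M := (le_abs_self _).trans (hM x hx)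
    have h2 : M ≤ M / η * x := by
      rw [div_mul_eq_mul_div, le_div_iff₀ hη]
      exact mul_le_mul_of_nonneg_left hxη hM0
    linarith

/-- When `κ` is not small, `w` is bounded: the field `φ - κ ψ` then lies below an affine function
that is negative at `0`, and otherwise too much mass would flow out through `0`. -/
lemma exists_le_of_le_kappa (h : IsCoefficientPair φ ψ) {k : ℝ} (hk : 0 < k) :
    ∃ N : ℝ, ∀ (c₀ : ℝ → ℝ) (w : ℝ → ℝ → ℝ) (κ : ℝ → ℝ), IsSolution φ ψ c₀ w κ →
      ∀ s, 0 ≤ s → k ≤ κ s → ∀ x ∈ Ioo (0 : ℝ) 1, w x s ≤ N := by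
  set γ := -derivWithin ψ (Ioc 0 1) 1 with hγ
  have hγ0 : 0 < γ := by linarith [h.deriv_psi_neg]
  obtain ⟨K, hK0, hK⟩ := h.exists_phi_le (δ := k * γ / 4) (by positivity)
  set A := k * γ / 4 with hA
  have hA0 : 0 < A := by positivity
  set D := K + k * γ / 2 with hD
  have hD0 : 0 < D := by positivity
  have hAD : A ≤ D := by linarith [mul_pos hk hγ0]
  refine ⟨(1 + D) / A, fun c₀ w κ hs s hs0 hks x hx => ?_⟩
  have hcont : ContinuousWithinAt κ (Ici s) s :=
    (hs.continuousOn_kappa s hs0).mono (Ici_subset_Ici.2 hs0)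
  obtain ⟨ε₀, hε₀, hκ'⟩ : ∃ ε₀ > 0, ∀ r ∈ Icc s (s + ε₀), k / 2 ≤ κ r := by
    have hev : ∀ᶠ r in 𝓝[≥] s, k / 2 < κ r := hcont.eventually (lt_mem_nhds (by linarith))
    obtain ⟨u, hu, hsub⟩ := mem_nhdsGE_iff_exists_Icc_subset.1 hev
    exact ⟨u - s, sub_pos.2 hu, fun r hr => (hsub ⟨hr.1, by linarith [hr.2]⟩ : k / 2 < κ r).le⟩
  have hfield : ∀ r ∈ Icc s (s + ε₀), ∀ y ∈ Icc (0 : ℝ) 1, φ y - κ r * ψ y ≤ -A + D * y := by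
    intro r hr y hy
    have h1 := hK y hy
    have h2 : k / 2 * (γ * (1 - y)) ≤ κ r * ψ y :=
      mul_le_mul (hκ' r hr) (h.le_psi hy) (mul_nonneg hγ0.le (by linarith [hy.2]))
        (le_trans (by linarith) (hκ' r hr))
    have h3 : k / 2 * (γ * (1 - y)) = 2 * A - k * γ / 2 * y := by rw [hA]; ring
    rw [hD]
    linarith
  have key : ∀ ε ∈ Ioo 0 (min ε₀ (x / A)), Real.exp (-D * ε) * (A * w x s) ≤ 1 + D := by
    intro ε hε
    have hε0 := hε.1
    have hε1 : ε ≤ ε₀ := hε.2.le.trans (min_le_left _ _)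
    have hεx : A * ε ≤ x := by
      have := hε.2.le.trans (min_le_right _ _)
      rw [le_div_iff₀ hA0] at this
      linarith
    set q := Real.exp (-D * ε) with hq
    have hq0 : 0 < q := Real.exp_pos _
    have hq1 : q ≤ 1 := by
      rw [hq, Real.exp_le_one_iff]
      nlinarith
    have hq2 : q * (1 + A * ε) ≤ 1 := by
      have h1 : 1 + A * ε ≤ Real.exp (D * ε) := by
        have := Real.add_one_le_exp (D * ε)
        nlinarith
      calc q * (1 + A * ε) ≤ q * Real.exp (D * ε) := by gcongr
        _ = 1 := by rw [hq, ← Real.exp_add]; simp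
    have hsε : 0 ≤ s + ε := by linarith
    have hpt : ∀ y ∈ Ioo (0 : ℝ) 1, w y (s + ε) ≤ Real.exp ε * w (q * y + q * (A * ε)) s := by
      intro y hy
      obtain ⟨X, hX, hXy, -⟩ := exists_backward_characteristic h (a := s) (b := s + ε)
        (hs.continuousOn_kappa.mono fun r hr => hs0.trans hr.1)
        (fun r hr => hs.kappa_pos h (hs0.trans hr.1)) (by linarith) hy
      have hmono : MonotoneOn (fun r => -(Real.exp (-D * (r - s)) * X r + A * q * (r - s)))
          (Icc s (s + ε)) := by
        refine monotoneOn_Icc_of_hasDerivWithinAt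
          (f' := fun r => -((Real.exp (-D * (r - s)) * (-D)) * X r
            + Real.exp (-D * (r - s)) * (φ (X r) - κ r * ψ (X r)) + A * q))
          (fun r hr => ?_) (fun r hr => ?_)
        · have e1 : HasDerivAt (fun r => -D * (r - s)) (-D) r := by
            simpa using ((hasDerivAt_id r).sub_const s).const_mul (-D)
          have e2 : HasDerivAt (fun r => A * q * (r - s)) (A * q) r := by
            simpa using ((hasDerivAt_id r).sub_const s).const_mul (A * q)
          exact ((e1.exp.hasDerivWithinAt.mul (hX r hr).2).add e2.hasDerivWithinAt).neg
        · have h1 := hfield r ⟨hr.1, by linarith [hr.2]⟩ (X r) ⟨(hX r hr).1.1, (hX r hr).1.2.le⟩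
          have h2 : q ≤ Real.exp (-D * (r - s)) := by
            rw [hq, Real.exp_le_exp]
            nlinarith [hr.2]
          have h3 := mul_le_mul_of_nonneg_left h1 (Real.exp_pos (-D * (r - s))).le
          nlinarith
      have := hmono (left_mem_Icc.2 (by linarith)) (right_mem_Icc.2 (by linarith))
        (by linarith : s ≤ s + ε)
      simp only [sub_self, mul_zero, Real.exp_zero, one_mul, add_sub_cancel_left, hXy,
        ← hq] at this
      have hw := hs.eq_exp_mul hs0 (by linarith) hX
      rw [hXy, add_sub_cancel_left] at hw
      have hXs := (hX s (left_mem_Icc.2 (by linarith))).1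
      have hle : q * y + q * (A * ε) ≤ X s := by linarith
      rw [hw]
      refine mul_le_mul_of_nonneg_left (hs.antitone s hs0 ⟨?_, hle.trans_lt hXs.2⟩ hXs hle)
        (Real.exp_pos _).le
      have := hy.1
      positivity
    have hα : q * (A * ε) ∈ Icc (0 : ℝ) 1 := ⟨by positivity, by nlinarith⟩
    have hβ : q * 1 + q * (A * ε) ∈ Icc (0 : ℝ) 1 := ⟨by positivity, by linarith⟩
    have hint : IntervalIntegrable (fun y => w (q * y + q * (A * ε)) s) volume 0 1 := by
      have h1 := (hs.intervalIntegrable hs0 hα hβ).comp_add_right (q * (A * ε))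
      have h2 := h1.comp_mul_left (c := q)
      simpa [hq0.ne'] using h2
    have hi1 : ∫ y in (0 : ℝ)..1, w y (s + ε)
        ≤ ∫ y in (0 : ℝ)..1, Real.exp ε * w (q * y + q * (A * ε)) s :=
      intervalIntegral.integral_mono_on_of_le_Ioo zero_le_one
        (hs.intervalIntegrable hsε (by simp) (by simp)) (hint.const_mul _) hpt
    rw [hs.mass _ hsε, intervalIntegral.integral_const_mul,
      intervalIntegral.integral_comp_mul_add (fun y => w y s) hq0.ne', mul_zero, zero_add,
      smul_eq_mul] at hi1
    have hi2 : ∫ y in (q * (A * ε))..(q * 1 + q * (A * ε)), w y s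
        ≤ ∫ y in (q * (A * ε))..1, w y s := by
      have h0 : ∫ y in (q * 1 + q * (A * ε))..1, (0 : ℝ)
          ≤ ∫ y in (q * 1 + q * (A * ε))..1, w y s :=
        intervalIntegral.integral_mono_on_of_le_Ioo hβ.2 intervalIntegrable_const
          (hs.intervalIntegrable hs0 hβ (by simp)) fun y hy =>
            hs.nonneg _ hs0 y ⟨hβ.1.trans hy.1.le, hy.2⟩
      simp only [intervalIntegral.integral_zero] at h0
      have := intervalIntegral.integral_add_adjacent_intervals (hs.intervalIntegrable hs0 hα hβ)
        (hs.intervalIntegrable hs0 hβ (by simp : (1 : ℝ) ∈ Icc (0 : ℝ) 1))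
      linarith
    have hi3 := hs.integral_le_one_sub hs0 hα.1
      (show q * (A * ε) ≤ x by nlinarith [mul_pos hA0 hε0]) hx
    have hi4 : 1 ≤ Real.exp ε * (q⁻¹ * (1 - q * (A * ε) * w x s)) :=
      hi1.trans (by gcongr; exact hi2.trans hi3)
    have hq3 : Real.exp (-(1 + D) * ε) ≤ 1 - q * (A * ε) * w x s := by
      have e : Real.exp (-(1 + D) * ε) * (Real.exp ε * q⁻¹) = 1 := by
        rw [hq, ← Real.exp_neg, ← Real.exp_add, ← Real.exp_add, Real.exp_eq_one_iff]
        ring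
      have := mul_le_mul_of_nonneg_left hi4 (Real.exp_pos (-(1 + D) * ε)).le
      rw [mul_one, ← mul_assoc (Real.exp ε), ← mul_assoc, e, one_mul] at this
      exact this
    have hq4 := Real.add_one_le_exp (-(1 + D) * ε)
    have : ε * (q * (A * w x s)) ≤ ε * (1 + D) := by linarith
    exact le_of_mul_le_mul_left this hε0
  have hlim : Tendsto (fun ε : ℝ => Real.exp (-D * ε) * (A * w x s)) (𝓝[>] 0) (𝓝 (A * w x s)) := by
    have : Continuous fun ε : ℝ => Real.exp (-D * ε) * (A * w x s) := by fun_prop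
    simpa using (this.tendsto 0).mono_left nhdsWithin_le_nhds
  have hfin : A * w x s ≤ 1 + D := by
    refine le_of_tendsto hlim ?_
    have : Ioo 0 (min ε₀ (x / A)) ∈ 𝓝[>] (0 : ℝ) :=
      Ioo_mem_nhdsGT (lt_min hε₀ (div_pos hx.1 hA0))
    filter_upwards [this] with ε hε using key ε hε
  rw [le_div_iff₀ hA0]
  linarith

end Mass

/-! ### Distortion of three characteristics -/

section Distortion

variable {φ ψ : ℝ → ℝ}

/-- Three non-negative weights which make a combination of the growth rates of
`log ((1 - x) / (1 - z))`, `1 / z - 1 / x` and `z - x` dominate `1 + κ`, whatever `κ > 0` is. -/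
lemma exists_weights {l₁ l₂ c C α γ Λ : ℝ} (hl₁ : 0 ≤ l₁) (hl₂ : 0 ≤ l₂) (hl : 0 < l₁ + l₂)
    (hc : 0 < c) (hC : 0 ≤ C) (hα : 0 ≤ α) (hγ : 0 < γ) (hΛ : 0 ≤ Λ) :
    ∃ c₁ c₂ c₃ : ℝ, 0 ≤ c₁ ∧ 0 ≤ c₂ ∧ 0 ≤ c₃ ∧ ∀ k, 0 < k →
      Λ * (1 + k) ≤ c₁ * (k * l₁ + l₂) + c₂ * (c - k * C) + c₃ * (k * γ - α) := by
  rcases hl₂.eq_or_lt with h | h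
  · have hl₁' : 0 < l₁ := by linarith
    refine ⟨(Λ + Λ / c * C) / l₁, Λ / c, 0, by positivity, by positivity, le_rfl, fun k hk => ?_⟩
    have e₁ : (Λ + Λ / c * C) / l₁ * (k * l₁ + l₂) = (Λ + Λ / c * C) * k := by
      rw [← h, add_zero]; field_simp
    have e₂ : Λ / c * (c - k * C) = Λ - Λ / c * C * k := by field_simp
    rw [e₁, e₂]
    linarith
  · refine ⟨(Λ + Λ / γ * α) / l₂, 0, Λ / γ, by positivity, le_rfl, by positivity, fun k hk => ?_⟩
    have e₁ : (Λ + Λ / γ * α) / l₂ * (k * l₁ + l₂)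
        = (Λ + Λ / γ * α) / l₂ * (k * l₁) + (Λ + Λ / γ * α) := by field_simp
    have e₂ : Λ / γ * (k * γ - α) = Λ * k - Λ / γ * α := by field_simp
    have e₃ : 0 ≤ (Λ + Λ / γ * α) / l₂ * (k * l₁) := by positivity
    rw [e₁, e₂]
    linarith

/-- Bounded distortion, uniformly in `κ` and in the time `s`: of three characteristics that are at
`a / 2`, `a` and `1 / 2` at time `s`, the outer two are at time `0` not much further apart than the
left two, and the right one is not much closer to `1` than the left one. -/
lemma exists_distortion_bound (h : IsCoefficientPair φ ψ) (h3 : HasSignedThirdDerivatives φ ψ)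
    {a : ℝ} (ha : a ∈ Ioo (0 : ℝ) (1 / 2)) :
    ∃ C > 0, ∀ (κ : ℝ → ℝ) (s : ℝ), 0 ≤ s → ContinuousOn κ (Icc 0 s) →
      (∀ r ∈ Icc 0 s, 0 < κ r) → ∀ X Y Z : ℝ → ℝ, IsCharacteristic φ ψ κ 0 s X →
      IsCharacteristic φ ψ κ 0 s Y → IsCharacteristic φ ψ κ 0 s Z →
      (∀ r ∈ Icc 0 s, 0 < X r) → (∀ r ∈ Icc 0 s, 0 < Y r) → (∀ r ∈ Icc 0 s, 1 / 2 ≤ Z r) →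
      X s = a / 2 → Y s = a → Z s = 1 / 2 →
      X 0 < Y 0 ∧ Y 0 < Z 0 ∧ Z 0 - X 0 ≤ C * (Y 0 - X 0) ∧ Z 0 - X 0 ≤ (1 - X 0) / 2 := by
  have ha0 := ha.1
  have ha1 := ha.2
  obtain ⟨l₁, l₂, hl₁, hl₂, hl, hψl, hφl⟩ := exists_curvature_bounds h h3
  have hξ : a / 2 ∈ Ioc (0 : ℝ) 1 := ⟨by linarith, by linarith⟩
  obtain ⟨Λ, hΛ, hchord⟩ := exists_chord_bound h3 hξ
  obtain ⟨c, hc, hφc⟩ := h.exists_antitoneOn_phi_div_sq hξ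
  obtain ⟨C, hC, hψC⟩ := h.exists_psi_div_sq_le hξ.1
  set α := -derivWithin φ (Ioc 0 1) 1 with hα
  set γ := -derivWithin ψ (Ioc 0 1) 1 with hγ
  obtain ⟨c₁, c₂, c₃, hc₁, hc₂, hc₃, hw⟩ := exists_weights hl₁ hl₂ hl hc hC
    (by linarith [h.deriv_phi_neg] : 0 ≤ α) (by linarith [h.deriv_psi_neg] : 0 < γ) hΛ
  refine ⟨Real.exp (Real.log (1 / a) + c₁ + c₂ * (2 / a) + c₃), Real.exp_pos _, ?_⟩
  intro κ s hs hκ hκ0 X Y Z hX hY hZ hX0 hY0 hZ2 hXs hYs hZs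
  have hZ0 : ∀ r ∈ Icc 0 s, 0 < Z r := fun r hr => by linarith [hZ2 r hr]
  have hXY := IsCharacteristic.lt h hκ hX hY hX0 hY0 hs (by rw [hXs, hYs]; linarith)
  have hYZ := IsCharacteristic.lt h hκ hY hZ hY0 hZ0 hs (by rw [hYs, hZs]; linarith)
  have hl0 : (0 : ℝ) ∈ Icc 0 s := left_mem_Icc.2 hs
  have hls : s ∈ Icc 0 s := right_mem_Icc.2 hs
  -- the logarithmic ratio of the distances to the fixed point `1` increases
  set W : ℝ → ℝ := fun r => Real.log (1 - X r) - Real.log (1 - Z r) with hW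
  set W' : ℝ → ℝ := fun r => -(φ (X r) - κ r * ψ (X r)) / (1 - X r)
    - -(φ (Z r) - κ r * ψ (Z r)) / (1 - Z r) with hW'
  have hWd : ∀ r ∈ Icc 0 s, HasDerivWithinAt W (W' r) (Icc 0 s) r := fun r hr =>
    ((hX r hr).2.const_sub 1 |>.log (by linarith [(hX r hr).1.2])).sub
      ((hZ r hr).2.const_sub 1 |>.log (by linarith [(hZ r hr).1.2]))
  have hWge : ∀ r ∈ Icc 0 s, (κ r * l₁ + l₂) * (Z r - X r) ≤ W' r := by
    intro r hr
    have hXm : X r ∈ Ioo (0 : ℝ) 1 := ⟨hX0 r hr, (hX r hr).1.2⟩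
    have hZm : Z r ∈ Ioo (0 : ℝ) 1 := ⟨hZ0 r hr, (hZ r hr).1.2⟩
    have hle : X r ≤ Z r := ((hXY r hr).trans (hYZ r hr)).le
    have e₁ := hφl hXm hZm hle
    have e₂ := mul_le_mul_of_nonneg_left (hψl hXm hZm hle) (hκ0 r hr).le
    simp only at e₁ e₂
    have e₃ : W' r = (φ (Z r) / (1 - Z r) - φ (X r) / (1 - X r))
        + κ r * (ψ (X r) / (1 - X r)) - κ r * (ψ (Z r) / (1 - Z r)) := by
      simp only [hW']; ring
    rw [e₃]
    linarith
  have hWmono : MonotoneOn W (Icc 0 s) := monotoneOn_Icc_of_hasDerivWithinAt hWd fun r hr =>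
    (mul_nonneg (add_nonneg (mul_nonneg (hκ0 r hr).le hl₁) hl₂)
      (by linarith [hXY r hr, hYZ r hr])).trans (hWge r hr)
  have hratio : ∀ r ∈ Icc 0 s, 1 - X r ≤ (2 - a) * (1 - Z r) := by
    intro r hr
    have h1 : 0 < 1 - X r := by linarith [(hX r hr).1.2]
    have h2 : 0 < 1 - Z r := by linarith [(hZ r hr).1.2]
    have := hWmono hr hls hr.2
    simp only [hW, hXs, hZs] at this
    rw [← Real.log_div h1.ne' h2.ne', ← Real.log_div (by linarith) (by norm_num),
      Real.log_le_log_iff (div_pos h1 h2) (by apply div_pos <;> linarith), div_le_iff₀ h2] at this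
    calc 1 - X r ≤ _ := this
      _ = _ := by ring
  have hXge : ∀ r ∈ Icc 0 s, a / 2 ≤ X r := fun r hr => by
    nlinarith [hratio r hr, hZ2 r hr]
  have hW0 : 0 ≤ W 0 := by
    have := Real.log_le_log (by linarith [(hZ 0 hl0).1.2] : 0 < 1 - Z 0)
      (by linarith [hXY 0 hl0, hYZ 0 hl0] : 1 - Z 0 ≤ 1 - X 0)
    simp only [hW]
    linarith
  have hWs : W s ≤ 1 := by
    simp only [hW, hXs, hZs]
    rw [← Real.log_div (by linarith) (by norm_num)]
    have := Real.log_le_sub_one_of_pos (show 0 < (1 - a / 2) / (1 - 1 / 2) by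
      apply div_pos <;> linarith)
    linarith [show (1 - a / 2) / (1 - 1 / 2) = 2 - a by ring]
  -- the distortion, corrected by three terms that stay bounded, increases
  set G : ℝ → ℝ := fun r => (Real.log (Z r - X r) - Real.log (Y r - X r)) + c₁ * W r
    + c₂ * ((Z r)⁻¹ - (X r)⁻¹) + c₃ * (Z r - X r) with hG
  have hGmono : MonotoneOn G (Icc 0 s) := by
    set b : ℝ → ℝ → ℝ := fun r x => φ x - κ r * ψ x with hb
    refine monotoneOn_Icc_of_hasDerivWithinAt (f' := fun r =>
      ((b r (Z r) - b r (X r)) / (Z r - X r) - (b r (Y r) - b r (X r)) / (Y r - X r))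
        + c₁ * W' r + c₂ * (-b r (Z r) / Z r ^ 2 - -b r (X r) / X r ^ 2)
        + c₃ * (b r (Z r) - b r (X r))) (fun r hr => ?_) (fun r hr => ?_)
    · have hYX : Y r - X r ≠ 0 := (sub_pos.2 (hXY r hr)).ne'
      have hZX : Z r - X r ≠ 0 := (sub_pos.2 ((hXY r hr).trans (hYZ r hr))).ne'
      have dX := (hX r hr).2
      have dY := (hY r hr).2
      have dZ := (hZ r hr).2
      exact (((((dZ.sub dX).log hZX).sub ((dY.sub dX).log hYX)).add ((hWd r hr).const_mul c₁)).add
        (((dZ.inv (hZ0 r hr).ne').sub (dX.inv (hX0 r hr).ne')).const_mul c₂)).add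
        ((dZ.sub dX).const_mul c₃)
    · have hxy := hXY r hr
      have hyz := hYZ r hr
      have hxz := hxy.trans hyz
      have hk := hκ0 r hr
      have hx := hXge r hr
      have hz1 := (hZ r hr).1.2.le
      have hx0 := hX0 r hr
      have hz0 := hZ0 r hr
      have hD : 0 < Z r - X r := sub_pos.2 hxz
      obtain ⟨p₁, p₂⟩ := hchord (X r) (Y r) (Z r) hx hxy hyz hz1
      have p₃ := mul_le_mul_of_nonneg_left p₂ hk.le
      have q₁ : -(Λ * (1 + κ r) * (Z r - X r)) ≤ (b r (Z r) - b r (X r)) / (Z r - X r)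
          - (b r (Y r) - b r (X r)) / (Y r - X r) := by
        have e : (b r (Z r) - b r (X r)) / (Z r - X r) - (b r (Y r) - b r (X r)) / (Y r - X r)
            = -((φ (Y r) - φ (X r)) / (Y r - X r) - (φ (Z r) - φ (X r)) / (Z r - X r))
              - κ r * ((ψ (Z r) - ψ (X r)) / (Z r - X r) - (ψ (Y r) - ψ (X r)) / (Y r - X r)) := by
          simp only [hb]; ring
        have p₄ : Λ * (1 + κ r) * (Z r - Y r) ≤ Λ * (1 + κ r) * (Z r - X r) :=
          mul_le_mul_of_nonneg_left (by linarith) (mul_nonneg hΛ (by linarith))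
        rw [e]
        linarith
      have q₂ := mul_le_mul_of_nonneg_left (hWge r hr) hc₁
      have q₃ : (c - κ r * C) * (Z r - X r) ≤ -b r (Z r) / Z r ^ 2 - -b r (X r) / X r ^ 2 := by
        have m₁ := hφc ⟨hx, hxz.le.trans hz1⟩ ⟨hx.trans hxz.le, hz1⟩ hxz.le
        have m₂ := mul_le_mul_of_nonneg_left
          (hψC (X r) ⟨hx, hxz.le.trans hz1⟩ (Z r) ⟨hx.trans hxz.le, hz1⟩ hxz.le) hk.le
        simp only at m₁
        have e : -b r (Z r) / Z r ^ 2 - -b r (X r) / X r ^ 2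
            = (φ (X r) / X r ^ 2 - φ (Z r) / Z r ^ 2)
              - κ r * (ψ (X r) / X r ^ 2 - ψ (Z r) / Z r ^ 2) := by
          simp only [hb]; ring
        rw [e]
        linarith
      have q₄ : (κ r * γ - α) * (Z r - X r) ≤ b r (Z r) - b r (X r) := by
        have m₁ := h.monotoneOn_phi_add ⟨hx0.le, hxz.le.trans hz1⟩ ⟨hz0.le, hz1⟩ hxz.le
        have m₂ := mul_le_mul_of_nonneg_left
          (h.antitoneOn_psi_sub ⟨hx0.le, hxz.le.trans hz1⟩ ⟨hz0.le, hz1⟩ hxz.le) hk.le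
        simp only at m₁ m₂
        simp only [hb, hα, hγ]
        linarith
      have q₅ := mul_le_mul_of_nonneg_left q₃ hc₂
      have q₆ := mul_le_mul_of_nonneg_left q₄ hc₃
      have q₇ := mul_le_mul_of_nonneg_right (hw (κ r) hk) hD.le
      linarith
  have hG0s := hGmono hl0 hls hs
  have hYX0 : 0 < Y 0 - X 0 := sub_pos.2 (hXY 0 hl0)
  have hZX0 : 0 < Z 0 - X 0 := sub_pos.2 ((hXY 0 hl0).trans (hYZ 0 hl0))
  refine ⟨hXY 0 hl0, hYZ 0 hl0, ?_, ?_⟩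
  · simp only [hG, hXs, hYs, hZs] at hG0s
    have e₁ : Real.log (1 / 2 - a / 2) - Real.log (a - a / 2) ≤ Real.log (1 / a) := by
      rw [← Real.log_div (by linarith) (by linarith)]
      refine Real.log_le_log (by apply div_pos <;> linarith) ?_
      rw [div_le_div_iff₀ (by linarith) ha0]
      nlinarith
    have e₂ : c₁ * W s ≤ c₁ * 1 := mul_le_mul_of_nonneg_left hWs hc₁
    have e₃ : 0 ≤ c₁ * W 0 := mul_nonneg hc₁ hW0
    have e₄ : c₂ * ((1 / 2 : ℝ)⁻¹ - (a / 2)⁻¹) ≤ 0 := by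
      refine mul_nonpos_of_nonneg_of_nonpos hc₂ (sub_nonpos.2 ?_)
      exact inv_anti₀ (by linarith) (by linarith)
    have e₅ : -(c₂ * (2 / a)) ≤ c₂ * ((Z 0)⁻¹ - (X 0)⁻¹) := by
      rw [← mul_neg]
      refine mul_le_mul_of_nonneg_left ?_ hc₂
      have := inv_anti₀ (by linarith : 0 < a / 2) (hXge 0 hl0)
      have := inv_pos.2 (hZ0 0 hl0)
      rw [inv_div] at *
      linarith
    have e₆ : c₃ * (1 / 2 - a / 2) ≤ c₃ * 1 := mul_le_mul_of_nonneg_left (by linarith) hc₃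
    have e₇ : 0 ≤ c₃ * (Z 0 - X 0) := mul_nonneg hc₃ hZX0.le
    have e₈ : Real.log (Z 0 - X 0) ≤ Real.log (1 / a) + c₁ + c₂ * (2 / a) + c₃
        + Real.log (Y 0 - X 0) := by
      linarith
    rw [← Real.exp_log hYX0, ← Real.exp_log hZX0, Real.exp_log hYX0, ← Real.exp_log hYX0,
      ← Real.exp_add]
    exact Real.exp_le_exp.2 e₈
  · have := hratio 0 hl0
    nlinarith [(hZ 0 hl0).1.2]

end Distortion

/-! ### Regularity of the initial tail -/

/-- A mean value inequality that only uses one-sided difference quotients: `c₀` is merely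
integrable, so the functions it is applied to need not be differentiable. -/
lemma sub_le_mul_of_local {f : ℝ → ℝ} {a b k : ℝ} (hab : a ≤ b) (hf : ContinuousOn f (Icc a b))
    (h : ∀ x ∈ Ico a b, ∃ q : ℝ → ℝ, ∃ c ≤ k, Tendsto q (𝓝[>] x) (𝓝 c) ∧
      ∀ z ∈ Ioo x b, f z - f x ≤ (z - x) * q z) : f b - f a ≤ k * (b - a) := by
  have := image_le_of_liminf_slope_right_le_deriv_boundary (f := f) (a := a) (b := b) hf
    (B := fun z => f a + k * (z - a)) (B' := fun _ => k) (by simp) (by fun_prop)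
    (fun x _ => by
      simpa using ((((hasDerivAt_id x).sub_const a).const_mul k).const_add (f a)).hasDerivWithinAt)
    (fun x hx r hr => by
      obtain ⟨q, c, hc, hq, hfq⟩ := h x hx
      have h1 : ∀ᶠ z in 𝓝[>] x, q z < r := hq.eventually (gt_mem_nhds (hc.trans_lt hr))
      have h2 : ∀ᶠ z in 𝓝[>] x, z ∈ Ioo x b := Ioo_mem_nhdsGT hx.2
      refine ((h1.and h2).mono fun z hz => ?_).frequently
      have hzx : 0 < z - x := sub_pos.2 hz.2.1
      rw [slope_def_field, div_lt_iff₀ hzx]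
      calc f z - f x ≤ (z - x) * q z := hfq z hz.2
        _ < r * (z - x) := by rw [mul_comm]; exact mul_lt_mul_of_pos_right hz.1 hzx)
    (right_mem_Icc.2 hab)
  linarith

section InitialData

variable {c₀ : ℝ → ℝ}

lemma IsInitialDensity.intervalIntegrable (hd : IsInitialDensity c₀) {x y : ℝ}
    (hx : x ∈ Icc (0 : ℝ) 1) (hy : y ∈ Icc (0 : ℝ) 1) : IntervalIntegrable c₀ volume x y := by
  refine hd.integrable.mono_set ?_
  rw [uIcc_of_le (zero_le_one' ℝ)]
  exact uIcc_subset_Icc hx hy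

lemma IsInitialDensity.tail_sub (hd : IsInitialDensity c₀) {x y : ℝ}
    (hx : x ∈ Icc (0 : ℝ) 1) (hy : y ∈ Icc (0 : ℝ) 1) :
    tail c₀ x - tail c₀ y = ∫ z in x..y, c₀ z := by
  have := intervalIntegral.integral_add_adjacent_intervals (hd.intervalIntegrable hx hy)
    (hd.intervalIntegrable hy (by simp : (1 : ℝ) ∈ Icc (0 : ℝ) 1))
  simp only [tail]
  linarith

lemma IsInitialDensity.continuousOn_tail (hd : IsInitialDensity c₀) :
    ContinuousOn (tail c₀) (Icc 0 1) := by
  have h1 : ContinuousOn (fun x => ∫ z in (0 : ℝ)..x, c₀ z) (Icc 0 1) := by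
    have := intervalIntegral.continuousOn_primitive_interval (μ := volume) (f := c₀) (a := 0)
      (b := 1) ((intervalIntegrable_iff_integrableOn_Icc_of_le zero_le_one).1 hd.integrable |>
        fun h => by rwa [uIcc_of_le (zero_le_one' ℝ)])
    rwa [uIcc_of_le (zero_le_one' ℝ)] at this
  refine ((continuousOn_const (c := tail c₀ 0)).sub h1).congr fun x hx => ?_
  have := hd.tail_sub (x := 0) (by simp) hx
  simp only [Pi.sub_apply]
  linarith

lemma IsInitialDensity.antitoneOn_tail (hd : IsInitialDensity c₀) :
    AntitoneOn (tail c₀) (Icc 0 1) := by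
  intro x hx y hy hxy
  have h0 : ∫ z in x..y, (0 : ℝ) ≤ ∫ z in x..y, c₀ z :=
    intervalIntegral.integral_mono_on_of_le_Ioo hxy intervalIntegrable_const
      (hd.intervalIntegrable hx hy) fun z hz => hd.nonneg z ⟨hx.1.trans hz.1.le, hz.2.trans_le hy.2⟩
  simp only [intervalIntegral.integral_zero, ← hd.tail_sub hx hy] at h0
  linarith

lemma IsInitialDensity.intervalIntegrable_tail (hd : IsInitialDensity c₀) {x y : ℝ}
    (hx : x ∈ Icc (0 : ℝ) 1) (hy : y ∈ Icc (0 : ℝ) 1) :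
    IntervalIntegrable (tail c₀) volume x y :=
  (hd.continuousOn_tail.mono (uIcc_subset_Icc hx hy)).intervalIntegrable

lemma IsInitialDensity.tail_tail_sub (hd : IsInitialDensity c₀) {x y : ℝ}
    (hx : x ∈ Icc (0 : ℝ) 1) (hy : y ∈ Icc (0 : ℝ) 1) :
    tail (tail c₀) x - tail (tail c₀) y = ∫ z in x..y, tail c₀ z := by
  have := intervalIntegral.integral_add_adjacent_intervals (hd.intervalIntegrable_tail hx hy)
    (hd.intervalIntegrable_tail hy (by simp : (1 : ℝ) ∈ Icc (0 : ℝ) 1))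
  simp only [tail] at this ⊢
  linarith

lemma IsInitialDensity.mul_le_tail_tail_sub (hd : IsInitialDensity c₀) {x y : ℝ}
    (hx : 0 ≤ x) (hxy : x ≤ y) (hy : y ≤ 1) :
    (y - x) * tail c₀ y ≤ tail (tail c₀) x - tail (tail c₀) y ∧
      tail (tail c₀) x - tail (tail c₀) y ≤ (y - x) * tail c₀ x := by
  have hx' : x ∈ Icc (0 : ℝ) 1 := ⟨hx, hxy.trans hy⟩
  have hy' : y ∈ Icc (0 : ℝ) 1 := ⟨hx.trans hxy, hy⟩
  have h1 : ∫ z in x..y, tail c₀ y ≤ ∫ z in x..y, tail c₀ z :=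
    intervalIntegral.integral_mono_on hxy intervalIntegrable_const
      (hd.intervalIntegrable_tail hx' hy') fun z hz =>
        hd.antitoneOn_tail ⟨hx.trans hz.1, hz.2.trans hy⟩ hy' hz.2
  have h2 : ∫ z in x..y, tail c₀ z ≤ ∫ z in x..y, tail c₀ x :=
    intervalIntegral.integral_mono_on hxy (hd.intervalIntegrable_tail hx' hy')
      intervalIntegrable_const fun z hz =>
        hd.antitoneOn_tail hx' ⟨hx.trans hz.1, hz.2.trans hy⟩ hz.1
  rw [intervalIntegral.integral_const, smul_eq_mul] at h1 h2
  rw [hd.tail_tail_sub hx' hy']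
  exact ⟨h1, h2⟩

lemma tail_one (f : ℝ → ℝ) : tail f 1 = 0 := by simp [tail]

lemma IsInitialDensity.tail_tail_pos (hd : IsInitialDensity c₀) {x : ℝ} (hx : x ∈ Ico (0 : ℝ) 1) :
    0 < tail (tail c₀) x := by
  have h1 := (hd.mul_le_tail_tail_sub hx.1 (y := (x + 1) / 2) (by linarith [hx.2])
    (by linarith [hx.2])).1
  have h2 := (hd.mul_le_tail_tail_sub (x := (x + 1) / 2) (y := 1) (by linarith [hx.1])
    (by linarith [hx.2]) le_rfl).1
  rw [tail_one, mul_zero, tail_one, sub_zero] at h2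
  have h3 := hd.tail_pos ((x + 1) / 2) ⟨by linarith [hx.1], by linarith [hx.2]⟩
  nlinarith [hx.2]

lemma IsInitialDensity.antitoneOn_tail_tail (hd : IsInitialDensity c₀) :
    AntitoneOn (tail (tail c₀)) (Icc 0 1) := by
  intro x hx y hy hxy
  have h1 := (hd.mul_le_tail_tail_sub hx.1 hxy hy.2).1
  have h2 : 0 ≤ tail c₀ y := by
    have := hd.antitoneOn_tail hy (by simp : (1 : ℝ) ∈ Icc (0 : ℝ) 1) hy.2
    rwa [tail_one] at this
  nlinarith

lemma IsInitialDensity.hasDerivAt_tail_tail (hd : IsInitialDensity c₀) {x : ℝ}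
    (hx : x ∈ Ioo (0 : ℝ) 1) : HasDerivAt (tail (tail c₀)) (-tail c₀ x) x := by
  have hc : ContinuousAt (tail c₀) x := hd.continuousOn_tail.continuousAt (Icc_mem_nhds hx.1 hx.2)
  refine intervalIntegral.integral_hasDerivAt_left
    (hd.intervalIntegrable_tail ⟨hx.1.le, hx.2.le⟩ (by simp)) ?_ hc
  exact (hd.continuousOn_tail.mono Ioo_subset_Icc_self).stronglyMeasurableAtFilter isOpen_Ioo x hx

/-- Close to `1` the density is comparable to `w² / h`, with constants close to `β₀`. -/
lemma IsInitialDensity.exists_density_bounds (hd : IsInitialDensity c₀) {β₀ b₁ b₂ : ℝ}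
    (hβ : Tendsto (betaFunction c₀) (𝓝[<] 1) (𝓝 β₀)) (h₁ : b₁ < β₀) (h₂ : β₀ < b₂) :
    ∃ z₁ ∈ Ioo (0 : ℝ) 1, ∀ z ∈ Ico z₁ 1,
      b₁ * (tail c₀ z ^ 2 / tail (tail c₀) z) ≤ c₀ z ∧
        c₀ z ≤ b₂ * (tail c₀ z ^ 2 / tail (tail c₀) z) := by
  have hev : ∀ᶠ z in 𝓝[<] (1 : ℝ), betaFunction c₀ z ∈ Ioo b₁ b₂ :=
    hβ.eventually (Ioo_mem_nhds h₁ h₂)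
  obtain ⟨l, hl, hsub⟩ := mem_nhdsLT_iff_exists_Ioo_subset.1 hev
  have hl1 : l < 1 := hl
  have hz₁ : max (1 / 2) ((l + 1) / 2) ∈ Ioo (0 : ℝ) 1 :=
    ⟨lt_of_lt_of_le (by norm_num) (le_max_left _ _), max_lt (by norm_num) (by linarith)⟩
  refine ⟨_, hz₁, fun z hz => ?_⟩
  have hz0 : z ∈ Ico (0 : ℝ) 1 := ⟨hz₁.1.le.trans hz.1, hz.2⟩
  have hlz : l < z := by
    have := (le_max_right (1 / 2) ((l + 1) / 2)).trans hz.1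
    linarith
  have hb : betaFunction c₀ z ∈ Ioo b₁ b₂ := hsub ⟨hlz, hz.2⟩
  have hw := hd.tail_pos z hz0
  have hh := hd.tail_tail_pos hz0
  have e : c₀ z = betaFunction c₀ z * (tail c₀ z ^ 2 / tail (tail c₀) z) := by
    rw [betaFunction]; field_simp
  have hq : 0 ≤ tail c₀ z ^ 2 / tail (tail c₀) z := by positivity
  rw [e]
  exact ⟨mul_le_mul_of_nonneg_right hb.1.le hq, mul_le_mul_of_nonneg_right hb.2.le hq⟩

section LocalBounds

variable {b₁ b₂ z₁ : ℝ}

lemma IsInitialDensity.le_tail_sub (hd : IsInitialDensity c₀) (hz₁ : 0 ≤ z₁) (hb₁ : 0 ≤ b₁)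
    (hb : ∀ z ∈ Ico z₁ 1, b₁ * (tail c₀ z ^ 2 / tail (tail c₀) z) ≤ c₀ z) {x y : ℝ}
    (hx : z₁ ≤ x) (hxy : x ≤ y) (hy : y < 1) :
    (y - x) * (b₁ * (tail c₀ y ^ 2 / tail (tail c₀) x)) ≤ tail c₀ x - tail c₀ y := by
  have hx' : x ∈ Icc (0 : ℝ) 1 := ⟨hz₁.trans hx, hxy.trans hy.le⟩
  have hy' : y ∈ Icc (0 : ℝ) 1 := ⟨hx'.1.trans hxy, hy.le⟩
  rw [hd.tail_sub hx' hy', ← smul_eq_mul, ← intervalIntegral.integral_const]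
  refine intervalIntegral.integral_mono_on hxy intervalIntegrable_const
    (hd.intervalIntegrable hx' hy') fun z hz => le_trans ?_ (hb z ⟨hx.trans hz.1, hz.2.trans_lt hy⟩)
  have hz' : z ∈ Ico (0 : ℝ) 1 := ⟨hx'.1.trans hz.1, hz.2.trans_lt hy⟩
  have h1 := hd.antitoneOn_tail (Ico_subset_Icc_self hz') hy' hz.2
  have h2 := hd.antitoneOn_tail_tail hx' (Ico_subset_Icc_self hz') hz.1
  have h3 := hd.tail_pos y ⟨hy'.1, hy⟩
  have h4 := hd.tail_tail_pos hz'
  gcongr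

lemma IsInitialDensity.tail_sub_le (hd : IsInitialDensity c₀) (hz₁ : 0 ≤ z₁) (hb₂ : 0 ≤ b₂)
    (hb : ∀ z ∈ Ico z₁ 1, c₀ z ≤ b₂ * (tail c₀ z ^ 2 / tail (tail c₀) z)) {x y : ℝ}
    (hx : z₁ ≤ x) (hxy : x ≤ y) (hy : y < 1) :
    tail c₀ x - tail c₀ y ≤ (y - x) * (b₂ * (tail c₀ x ^ 2 / tail (tail c₀) y)) := by
  have hx' : x ∈ Icc (0 : ℝ) 1 := ⟨hz₁.trans hx, hxy.trans hy.le⟩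
  have hy' : y ∈ Icc (0 : ℝ) 1 := ⟨hx'.1.trans hxy, hy.le⟩
  rw [hd.tail_sub hx' hy', ← smul_eq_mul, ← intervalIntegral.integral_const]
  refine intervalIntegral.integral_mono_on hxy (hd.intervalIntegrable hx' hy')
    intervalIntegrable_const fun z hz => le_trans (hb z ⟨hx.trans hz.1, hz.2.trans_lt hy⟩) ?_
  have hz' : z ∈ Ico (0 : ℝ) 1 := ⟨hx'.1.trans hz.1, hz.2.trans_lt hy⟩
  have h1 := hd.antitoneOn_tail hx' (Ico_subset_Icc_self hz') hz.1
  have h2 := hd.antitoneOn_tail_tail (Ico_subset_Icc_self hz') hy' hz.2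
  have h3 := hd.tail_pos z hz'
  have h4 := hd.tail_tail_pos (x := y) ⟨hy'.1, hy⟩
  gcongr

lemma IsInitialDensity.tendsto_tail (hd : IsInitialDensity c₀) {x : ℝ} (hx : x ∈ Ioo (0 : ℝ) 1) :
    Tendsto (tail c₀) (𝓝[>] x) (𝓝 (tail c₀ x)) ∧
      Tendsto (tail (tail c₀)) (𝓝[>] x) (𝓝 (tail (tail c₀) x)) :=
  ⟨(hd.continuousOn_tail.continuousAt (Icc_mem_nhds hx.1 hx.2)).tendsto.mono_left
    nhdsWithin_le_nhds, (hd.hasDerivAt_tail_tail hx).continuousAt.tendsto.mono_left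
    nhdsWithin_le_nhds⟩

lemma IsInitialDensity.continuousOn_tails (hd : IsInitialDensity c₀) {x y : ℝ} (hx : 0 < x)
    (hy : y < 1) : ContinuousOn (tail c₀) (Icc x y) ∧ ContinuousOn (tail (tail c₀)) (Icc x y) :=
  ⟨hd.continuousOn_tail.mono (Icc_subset_Icc hx.le hy.le), fun _ hz =>
    (hd.hasDerivAt_tail_tail ⟨hx.trans_le hz.1, hz.2.trans_lt hy⟩).continuousAt.continuousWithinAt⟩

/-- `(h / w)' = β - 1 ≥ b₁ - 1`, integrated. -/
lemma IsInitialDensity.meanResidual_ge (hd : IsInitialDensity c₀) (hz₁ : 0 < z₁) (hb₁ : 0 ≤ b₁)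
    (hb : ∀ z ∈ Ico z₁ 1, b₁ * (tail c₀ z ^ 2 / tail (tail c₀) z) ≤ c₀ z) {x y : ℝ}
    (hx : z₁ ≤ x) (hxy : x ≤ y) (hy : y < 1) :
    tail (tail c₀) x / tail c₀ x - (1 - b₁) * (y - x) ≤ tail (tail c₀) y / tail c₀ y := by
  obtain ⟨cw, ch⟩ := hd.continuousOn_tails (hz₁.trans_le hx) hy
  have hmem : ∀ z ∈ Icc x y, z ∈ Ioo (0 : ℝ) 1 := fun z hz =>
    ⟨(hz₁.trans_le hx).trans_le hz.1, hz.2.trans_lt hy⟩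
  have hwp : ∀ z ∈ Icc x y, 0 < tail c₀ z := fun z hz =>
    hd.tail_pos z (Ioo_subset_Ico_self (hmem z hz))
  have := sub_le_mul_of_local (f := fun z => -(tail (tail c₀) z / tail c₀ z)) (k := 1 - b₁) hxy
    (ch.div cw fun z hz => (hwp z hz).ne').neg (fun p hp => by
      have hp' := Ico_subset_Icc_self hp
      have w0 := hwp p hp'
      have h0 := hd.tail_tail_pos (Ioo_subset_Ico_self (hmem p hp'))
      obtain ⟨tw, th⟩ := hd.tendsto_tail (hmem p hp')
      refine ⟨fun z => 1 - b₁ * (tail c₀ z * tail (tail c₀) z / (tail c₀ p * tail (tail c₀) p)),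
        1 - b₁, le_rfl, ?_, fun z hz => ?_⟩
      · have := (((tw.mul th).div_const (tail c₀ p * tail (tail c₀) p)).const_mul b₁).const_sub 1
        rwa [div_self (by positivity), mul_one] at this
      · have hz' : z ∈ Icc x y := ⟨hp.1.trans hz.1.le, hz.2.le⟩
        have w1 := hwp z hz'
        have h1 := hd.tail_tail_pos (Ioo_subset_Ico_self (hmem z hz'))
        have e₁ := hd.le_tail_sub hz₁.le hb₁ hb (hx.trans hp.1) hz.1.le (hz.2.trans hy)
        have e₂ := (hd.mul_le_tail_tail_sub (hmem p hp').1.le hz.1.le (hmem z hz').2.le).2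
        set W := tail c₀ z
        set H := tail (tail c₀) z
        set W₀ := tail c₀ p
        set H₀ := tail (tail c₀) p
        have e₃ : -(H / W) - -(H₀ / W₀) = (W * (H₀ - H) - H * (W₀ - W)) / (W₀ * W) := by
          field_simp; ring
        have e₄ : W * (H₀ - H) - H * (W₀ - W)
            ≤ W * ((z - p) * W₀) - H * ((z - p) * (b₁ * (W ^ 2 / H₀))) :=
          sub_le_sub (mul_le_mul_of_nonneg_left e₂ w1.le) (mul_le_mul_of_nonneg_left e₁ h1.le)
        have e₅ : (W * ((z - p) * W₀) - H * ((z - p) * (b₁ * (W ^ 2 / H₀)))) / (W₀ * W)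
            = (z - p) * (1 - b₁ * (W * H / (W₀ * H₀))) := by
          field_simp
        show -(H / W) - -(H₀ / W₀) ≤ (z - p) * (1 - b₁ * (W * H / (W₀ * H₀)))
        rw [e₃, ← e₅]
        gcongr)
  linarith

/-- `(h / w)' = β - 1 ≤ b₂ - 1`, integrated. -/
lemma IsInitialDensity.meanResidual_le (hd : IsInitialDensity c₀) (hz₁ : 0 < z₁) (hb₂ : 0 ≤ b₂)
    (hb : ∀ z ∈ Ico z₁ 1, c₀ z ≤ b₂ * (tail c₀ z ^ 2 / tail (tail c₀) z)) {x y : ℝ}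
    (hx : z₁ ≤ x) (hxy : x ≤ y) (hy : y < 1) :
    tail (tail c₀) y / tail c₀ y ≤ tail (tail c₀) x / tail c₀ x - (1 - b₂) * (y - x) := by
  obtain ⟨cw, ch⟩ := hd.continuousOn_tails (hz₁.trans_le hx) hy
  have hmem : ∀ z ∈ Icc x y, z ∈ Ioo (0 : ℝ) 1 := fun z hz =>
    ⟨(hz₁.trans_le hx).trans_le hz.1, hz.2.trans_lt hy⟩
  have hwp : ∀ z ∈ Icc x y, 0 < tail c₀ z := fun z hz =>
    hd.tail_pos z (Ioo_subset_Ico_self (hmem z hz))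
  have := sub_le_mul_of_local (f := fun z => tail (tail c₀) z / tail c₀ z) (k := b₂ - 1) hxy
    (ch.div cw fun z hz => (hwp z hz).ne') (fun p hp => by
      have hp' := Ico_subset_Icc_self hp
      have w0 := hwp p hp'
      obtain ⟨tw, -⟩ := hd.tendsto_tail (hmem p hp')
      refine ⟨fun z => b₂ * (tail c₀ p / tail c₀ z) - tail c₀ z / tail c₀ p,
        b₂ - 1, le_rfl, ?_, fun z hz => ?_⟩
      · have := ((tendsto_const_nhds (x := tail c₀ p)).div tw w0.ne' |>.const_mul b₂).sub
          (tw.div_const (tail c₀ p))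
        simpa [div_self w0.ne'] using this
      · have hz' : z ∈ Icc x y := ⟨hp.1.trans hz.1.le, hz.2.le⟩
        have w1 := hwp z hz'
        have h1 := hd.tail_tail_pos (Ioo_subset_Ico_self (hmem z hz'))
        have e₁ := hd.tail_sub_le hz₁.le hb₂ hb (hx.trans hp.1) hz.1.le (hz.2.trans hy)
        have e₂ := (hd.mul_le_tail_tail_sub (hmem p hp').1.le hz.1.le (hmem z hz').2.le).1
        set W := tail c₀ z
        set H := tail (tail c₀) z
        set W₀ := tail c₀ p
        set H₀ := tail (tail c₀) p
        have e₃ : H / W - H₀ / W₀ = (H * (W₀ - W) - W * (H₀ - H)) / (W₀ * W) := by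
          field_simp; ring
        have e₄ : H * (W₀ - W) - W * (H₀ - H)
            ≤ H * ((z - p) * (b₂ * (W₀ ^ 2 / H))) - W * ((z - p) * W) :=
          sub_le_sub (mul_le_mul_of_nonneg_left e₁ h1.le) (mul_le_mul_of_nonneg_left e₂ w1.le)
        have e₅ : (H * ((z - p) * (b₂ * (W₀ ^ 2 / H))) - W * ((z - p) * W)) / (W₀ * W)
            = (z - p) * (b₂ * (W₀ / W) - W / W₀) := by
          field_simp
        show H / W - H₀ / W₀ ≤ (z - p) * (b₂ * (W₀ / W) - W / W₀)
        rw [e₃, ← e₅]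
        gcongr)
  linarith

/-- `(1 / w)' = β / h ≤ b₂ / h`, integrated. -/
lemma IsInitialDensity.inv_tail_le (hd : IsInitialDensity c₀) (hz₁ : 0 < z₁) (hb₂ : 0 ≤ b₂)
    (hb : ∀ z ∈ Ico z₁ 1, c₀ z ≤ b₂ * (tail c₀ z ^ 2 / tail (tail c₀) z)) {x y : ℝ}
    (hx : z₁ ≤ x) (hxy : x ≤ y) (hy : y < 1) :
    (tail c₀ y)⁻¹ ≤ (tail c₀ x)⁻¹ + b₂ / tail (tail c₀) y * (y - x) := by
  obtain ⟨cw, -⟩ := hd.continuousOn_tails (hz₁.trans_le hx) hy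
  have hmem : ∀ z ∈ Icc x y, z ∈ Ioo (0 : ℝ) 1 := fun z hz =>
    ⟨(hz₁.trans_le hx).trans_le hz.1, hz.2.trans_lt hy⟩
  have hwp : ∀ z ∈ Icc x y, 0 < tail c₀ z := fun z hz =>
    hd.tail_pos z (Ioo_subset_Ico_self (hmem z hz))
  have := sub_le_mul_of_local (f := fun z => (tail c₀ z)⁻¹) (k := b₂ / tail (tail c₀) y) hxy
    (cw.inv₀ fun z hz => (hwp z hz).ne') (fun p hp => by
      have hp' := Ico_subset_Icc_self hp
      have w0 := hwp p hp'
      obtain ⟨tw, -⟩ := hd.tendsto_tail (hmem p hp')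
      have hy0 := hd.tail_tail_pos (Ioo_subset_Ico_self (hmem y (right_mem_Icc.2 hxy)))
      refine ⟨fun z => b₂ / tail (tail c₀) y * (tail c₀ p / tail c₀ z),
        b₂ / tail (tail c₀) y, le_rfl, ?_, fun z hz => ?_⟩
      · have := ((tendsto_const_nhds (x := tail c₀ p)).div tw w0.ne').const_mul
          (b₂ / tail (tail c₀) y)
        rwa [div_self w0.ne', mul_one] at this
      · have hz' : z ∈ Icc x y := ⟨hp.1.trans hz.1.le, hz.2.le⟩
        have w1 := hwp z hz'
        have h1 := hd.tail_tail_pos (Ioo_subset_Ico_self (hmem z hz'))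
        have e₁ := hd.tail_sub_le hz₁.le hb₂ hb (hx.trans hp.1) hz.1.le (hz.2.trans hy)
        have e₂ := hd.antitoneOn_tail_tail (Ioo_subset_Icc_self (hmem z hz'))
          (Ioo_subset_Icc_self (hmem y (right_mem_Icc.2 hxy))) hz.2.le
        have hzp : 0 ≤ z - p := sub_nonneg.2 hz.1.le
        set W := tail c₀ z
        set H := tail (tail c₀) z
        set W₀ := tail c₀ p
        set H₁ := tail (tail c₀) y
        have e₃ : W⁻¹ - W₀⁻¹ = (W₀ - W) / (W₀ * W) := by field_simp
        have e₄ : W₀ - W ≤ (z - p) * (b₂ * (W₀ ^ 2 / H₁)) :=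
          e₁.trans (by gcongr)
        have e₅ : (z - p) * (b₂ * (W₀ ^ 2 / H₁)) / (W₀ * W)
            = (z - p) * (b₂ / H₁ * (W₀ / W)) := by
          field_simp
        show W⁻¹ - W₀⁻¹ ≤ (z - p) * (b₂ / H₁ * (W₀ / W))
        rw [e₃, ← e₅]
        gcongr)
  linarith

end LocalBounds

/-- Regularity of the tail `w₀`: if `w₀` loses at most a fixed proportion between `x` and `y`,
then it also does so between `x` and `z`, when `z - x ≤ C (y - x)`.  This is where `β₀ > 0` is used:
it bounds `y - x` by a multiple of `m x`, where `m = h₀ / w₀`. -/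
lemma IsInitialDensity.exists_tail_ge (hd : IsInitialDensity c₀) {β₀ : ℝ}
    (hβ : Tendsto (betaFunction c₀) (𝓝[<] 1) (𝓝 β₀)) (hβ₀ : 0 < β₀) (hβ₁ : β₀ ≤ 1) {C ρ : ℝ}
    (hC : 0 < C) (hρ : 0 < ρ) :
    ∃ z₁ ∈ Ioo (0 : ℝ) 1, ∃ p > 0, ∀ x y z, z₁ ≤ x → x < y → y < z → z < 1 →
      z - x ≤ C * (y - x) → z - x ≤ (1 - x) / 2 → ρ * tail c₀ x ≤ tail c₀ y →
      p * tail c₀ x ≤ tail c₀ z := by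
  set C₁ := C * (2 / (β₀ * ρ ^ 2)) with hC₁
  have hC₁0 : 0 < C₁ := by positivity
  set ε := min (β₀ / 2) (1 / (8 * C₁)) with hε
  have hε0 : 0 < ε := lt_min (by positivity) (by positivity)
  have hε1 : ε ≤ β₀ / 2 := min_le_left _ _
  have hε2 : 2 * ε * C₁ ≤ 1 / 4 := by
    have : ε ≤ 1 / (8 * C₁) := min_le_right _ _
    rw [le_div_iff₀ (by positivity)] at this
    linarith
  obtain ⟨z₁, hz₁, hb⟩ := hd.exists_density_bounds hβ (b₁ := β₀ - ε) (b₂ := β₀ + ε)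
    (by linarith) (by linarith)
  have hbl := fun z hz => (hb z hz).1
  have hbu := fun z hz => (hb z hz).2
  have hb₁0 : 0 ≤ β₀ - ε := by linarith
  have hb₂0 : 0 ≤ β₀ + ε := by linarith
  refine ⟨z₁, hz₁, (1 + 2 * C₁ * Real.exp (4 * C₁))⁻¹, by positivity, ?_⟩
  intro x y z hx hxy hyz hz1 hzC hz2 hρy
  have hx0 : 0 < x := hz₁.1.trans_le hx
  have hxz := hxy.trans hyz
  have hxm : x ∈ Ico (0 : ℝ) 1 := ⟨hx0.le, hxz.trans hz1⟩
  have hw0 := hd.tail_pos x hxm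
  have hh0 := hd.tail_tail_pos hxm
  set W := tail c₀ x with hW
  set H := tail (tail c₀) x with hH
  set m := H / W with hm
  have hm0 : 0 < m := div_pos hh0 hw0
  -- the length of the interval is at most a multiple of `m`
  have hlen : z - x ≤ C₁ * m := by
    have h1 := hd.le_tail_sub hz₁.1.le hb₁0 hbl hx hxy.le (hyz.trans hz1)
    have h2 : 0 < tail c₀ y := hd.tail_pos y ⟨hx0.le.trans hxy.le, hyz.trans hz1⟩
    have h3 : (y - x) * (β₀ / 2 * ((ρ * W) ^ 2 / H)) ≤ W := by
      have h4 : (y - x) * (β₀ / 2 * ((ρ * W) ^ 2 / H))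
          ≤ (y - x) * ((β₀ - ε) * (tail c₀ y ^ 2 / H)) := by
        have := sub_nonneg.2 hxy.le
        have h5 : β₀ / 2 ≤ β₀ - ε := by linarith
        gcongr
      linarith
    have h6 : y - x ≤ 2 / (β₀ * ρ ^ 2) * m := by
      have e : (y - x) * (β₀ / 2 * ((ρ * W) ^ 2 / H)) =
          (y - x) * (β₀ * ρ ^ 2 * W ^ 2) / (2 * H) := by
        field_simp
      rw [e, div_le_iff₀ (by positivity)] at h3
      rw [hm, div_mul_div_comm, le_div_iff₀ (by positivity)]
      have : W * ((y - x) * (β₀ * ρ ^ 2 * W)) ≤ W * (2 * H) := by linarith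
      exact le_of_mul_le_mul_left this hw0
    calc z - x ≤ C * (y - x) := hzC
      _ ≤ C * (2 / (β₀ * ρ ^ 2) * m) := by gcongr
      _ = C₁ * m := by rw [hC₁]; ring
  -- `m` is at least as large as for a power law with exponent given by `β₀ + ε`
  have hmfar : (1 - (β₀ + ε)) * (1 - x) ≤ m := by
    have hlim : Tendsto (fun u : ℝ => (1 - (β₀ + ε)) * (u - x)) (𝓝[<] 1)
        (𝓝 ((1 - (β₀ + ε)) * (1 - x))) := by
      have : Continuous fun u : ℝ => (1 - (β₀ + ε)) * (u - x) := by fun_prop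
      exact (this.tendsto 1).mono_left nhdsWithin_le_nhds
    refine le_of_tendsto hlim ?_
    filter_upwards [Ioo_mem_nhdsLT hxm.2] with u hu
    have h1 := hd.meanResidual_le hz₁.1 hb₂0 hbu hx hu.1.le hu.2
    have hum : u ∈ Ico (0 : ℝ) 1 := ⟨hx0.le.trans hu.1.le, hu.2⟩
    have h2 := div_pos (hd.tail_tail_pos hum) (hd.tail_pos u hum)
    rw [← hH, ← hW, ← hm] at h1
    linarith
  have hmge : ∀ u ∈ Icc x z, m / 4 ≤ tail (tail c₀) u / tail c₀ u := by
    intro u hu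
    have h1 := hd.meanResidual_ge hz₁.1 hb₁0 hbl hx hu.1 (hu.2.trans_lt hz1)
    rw [← hH, ← hW, ← hm] at h1
    have h2 : 2 * ε * (u - x) ≤ m / 4 := by
      calc 2 * ε * (u - x) ≤ 2 * ε * (C₁ * m) := by
            gcongr
            linarith [hu.2]
        _ = 2 * ε * C₁ * m := by ring
        _ ≤ 1 / 4 * m := by gcongr
        _ = m / 4 := by ring
    have h3 : (1 - (β₀ + ε)) * (u - x) ≤ m / 2 := by
      rcases le_total 0 (1 - (β₀ + ε)) with h | h
      · have : (1 - (β₀ + ε)) * (u - x) ≤ (1 - (β₀ + ε)) * ((1 - x) / 2) := by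
          gcongr
          linarith [hu.2]
        linarith
      · have := mul_nonpos_of_nonpos_of_nonneg h (sub_nonneg.2 hu.1)
        linarith
    linarith
  -- hence `h₀` decreases at most exponentially on the scale `m`
  have hexp : H * Real.exp (-(4 * C₁)) ≤ tail (tail c₀) z := by
    have hmono : MonotoneOn (fun u => tail (tail c₀) u * Real.exp (4 / m * (u - x))) (Icc x z) := by
      refine monotoneOn_Icc_of_hasDerivWithinAt (f' := fun u => -tail c₀ u
        * Real.exp (4 / m * (u - x)) + tail (tail c₀) u * (Real.exp (4 / m * (u - x)) * (4 / m)))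
        (fun u hu => ?_) (fun u hu => ?_)
      · have hd1 := hd.hasDerivAt_tail_tail (x := u) ⟨hx0.trans_le hu.1, hu.2.trans_lt hz1⟩
        have hd2 : HasDerivAt (fun u => 4 / m * (u - x)) (4 / m) u := by
          simpa using ((hasDerivAt_id u).sub_const x).const_mul (4 / m)
        exact (hd1.mul hd2.exp).hasDerivWithinAt
      · have h1 := hmge u hu
        have hwu := hd.tail_pos u ⟨hx0.le.trans hu.1, hu.2.trans_lt hz1⟩
        rw [le_div_iff₀ hwu] at h1
        have h2 : tail c₀ u ≤ tail (tail c₀) u * (4 / m) := by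
          rw [mul_div_assoc', le_div_iff₀ hm0]
          linarith
        have h3 := mul_le_mul_of_nonneg_right h2 (Real.exp_pos (4 / m * (u - x))).le
        linarith
    have h1 := hmono (left_mem_Icc.2 hxz.le) (right_mem_Icc.2 hxz.le) hxz.le
    simp only [sub_self, mul_zero, Real.exp_zero, mul_one] at h1
    have h2 : Real.exp (4 / m * (z - x)) ≤ Real.exp (4 * C₁) := by
      rw [Real.exp_le_exp]
      calc 4 / m * (z - x) ≤ 4 / m * (C₁ * m) := by gcongr
        _ = 4 * C₁ := by field_simp
    have hhz := hd.tail_tail_pos (x := z) ⟨hx0.le.trans hxz.le, hz1⟩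
    calc H * Real.exp (-(4 * C₁))
        ≤ tail (tail c₀) z * Real.exp (4 * C₁) * Real.exp (-(4 * C₁)) := by
          gcongr
          exact h1.trans (by gcongr)
      _ = tail (tail c₀) z := by rw [mul_assoc, ← Real.exp_add]; simp
  have hwz := hd.tail_pos z ⟨hx0.le.trans hxz.le, hz1⟩
  have hinv : (tail c₀ z)⁻¹ ≤ (1 + 2 * C₁ * Real.exp (4 * C₁)) * W⁻¹ := by
    have h1 := hd.inv_tail_le hz₁.1 hb₂0 hbu hx hxz.le hz1
    have h2 : (β₀ + ε) / tail (tail c₀) z ≤ 2 / (H * Real.exp (-(4 * C₁))) := by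
      gcongr
      linarith
    have h3 : (β₀ + ε) / tail (tail c₀) z * (z - x)
        ≤ 2 / (H * Real.exp (-(4 * C₁))) * (C₁ * m) := by
      have := sub_nonneg.2 hxz.le
      gcongr
    have h4 : 2 / (H * Real.exp (-(4 * C₁))) * (C₁ * m) = 2 * C₁ * Real.exp (4 * C₁) * W⁻¹ := by
      rw [Real.exp_neg, hm]
      field_simp
    rw [h4] at h3
    linarith
  have h1 : W ≤ (1 + 2 * C₁ * Real.exp (4 * C₁)) * tail c₀ z := by
    have := mul_le_mul_of_nonneg_right hinv (mul_pos hw0 hwz).le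
    have e1 : (tail c₀ z)⁻¹ * (W * tail c₀ z) = W := by field_simp
    have e2 : (1 + 2 * C₁ * Real.exp (4 * C₁)) * W⁻¹ * (W * tail c₀ z)
        = (1 + 2 * C₁ * Real.exp (4 * C₁)) * tail c₀ z := by field_simp
    rwa [e1, e2] at this
  rw [inv_mul_le_iff₀ (by positivity)]
  exact h1

end InitialData

/-! ### The uniform bound -/

section UniformBound

variable {φ ψ c₀ κ : ℝ → ℝ} {w : ℝ → ℝ → ℝ}

/-- The value of `w` at `(x, t)`, traced back to time `s`. -/
lemma IsSolution.exists_backward (h : IsCoefficientPair φ ψ) (hs : IsSolution φ ψ c₀ w κ)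
    {s t x : ℝ} (hs0 : 0 ≤ s) (hst : s ≤ t) (hx : x ∈ Ioo (0 : ℝ) 1) :
    ∃ X : ℝ → ℝ, IsCharacteristic φ ψ κ s t X ∧ X t = x ∧ (∀ r ∈ Icc s t, X r ∈ Ioo (0 : ℝ) 1) ∧
      w x t = Real.exp (t - s) * w (X s) s := by
  obtain ⟨X, hX, hXt, hX0⟩ := exists_backward_characteristic h
    (hs.continuousOn_kappa.mono fun r hr => hs0.trans hr.1)
    (fun r hr => hs.kappa_pos h (hs0.trans hr.1)) hst hx
  have := hs.eq_exp_mul hs0 hst hX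
  rw [hXt] at this
  exact ⟨X, hX, hXt, fun r hr => ⟨hX0 r hr, (hX r hr).1.2⟩, this⟩

/-- When `w (·, s) ≤ N` with `N ≥ 1`, at least half of the mass lies to the right of `1 / (2 N)`. -/
lemma IsSolution.half_le (hs : IsSolution φ ψ c₀ w κ) {s N : ℝ} (hs0 : 0 ≤ s) (hN1 : 1 ≤ N)
    (hN : ∀ x ∈ Ioo (0 : ℝ) 1, w x s ≤ N) : 1 / 2 ≤ w (1 / (2 * N)) s := by
  have hN0 : 0 < N := by linarith
  have ha0 : 0 < 1 / (2 * N) := by positivity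
  have ha1 : 1 / (2 * N) ≤ 1 / 2 := by
    apply one_div_le_one_div_of_le <;> linarith
  have ha : 1 / (2 * N) ∈ Icc (0 : ℝ) 1 := ⟨ha0.le, by linarith⟩
  have h1 := hs.one_sub_le_integral hs0 ha hN
  have h2 : ∫ y in (1 / (2 * N))..1, w y s ≤ ∫ y in (1 / (2 * N))..1, w (1 / (2 * N)) s :=
    intervalIntegral.integral_mono_on_of_le_Ioo ha.2 (hs.intervalIntegrable hs0 ha (by simp))
      intervalIntegrable_const fun y hy => hs.antitone s hs0 ⟨ha.1, by linarith⟩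
        ⟨ha.1.trans hy.1.le, hy.2⟩ hy.1.le
  rw [intervalIntegral.integral_const, smul_eq_mul] at h2
  have h3 : 1 / (2 * N) * N = 1 / 2 := by field_simp
  have h4 := mul_nonneg ha.1 (hs.nonneg s hs0 (1 / (2 * N)) ⟨ha.1, by linarith⟩)
  linarith

lemma exists_first_time {X : ℝ → ℝ} {t : ℝ} (ht : 0 ≤ t) (hX : ContinuousOn X (Icc 0 t))
    (hXt : X t ≤ 1 / 2) :
    ∃ s ∈ Icc 0 t, X s ≤ 1 / 2 ∧ ∀ r ∈ Ico 0 s, 1 / 2 < X r := by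
  have hc : IsCompact (Icc 0 t ∩ X ⁻¹' Iic (1 / 2)) :=
    isCompact_Icc.of_isClosed_subset (hX.preimage_isClosed_of_isClosed isClosed_Icc isClosed_Iic)
      inter_subset_left
  obtain ⟨s, ⟨hs, hsX⟩, hmin⟩ := hc.exists_isLeast ⟨t, right_mem_Icc.2 ht, hXt⟩
  refine ⟨s, hs, hsX, fun r hr => ?_⟩
  by_contra hn
  exact absurd (hmin ⟨⟨hr.1, hr.2.le.trans hs.2⟩, not_lt.1 hn⟩) (not_le.2 hr.2)

/-- A uniform bound for `w`, depending only on the coefficients and on the initial data. -/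
lemma exists_uniform_bound (h : IsCoefficientPair φ ψ) (h3 : HasSignedThirdDerivatives φ ψ)
    (hd : IsInitialDensity c₀) {β₀ : ℝ} (hβ : Tendsto (betaFunction c₀) (𝓝[<] 1) (𝓝 β₀))
    (hβ₀ : 0 < β₀) (hβ₁ : β₀ ≤ 1) :
    ∃ N > 0, ∀ (w : ℝ → ℝ → ℝ) (κ : ℝ → ℝ), IsSolution φ ψ c₀ w κ →
      ∀ t, 0 ≤ t → ∀ x ∈ Ioo (0 : ℝ) 1, w x t ≤ N := by
  have hhalf : (1 / 2 : ℝ) ∈ Ioo (0 : ℝ) 1 := by norm_num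
  have hψ2 : 0 < ψ (1 / 2) := h.psi_pos (Ioo_subset_Ico_self hhalf)
  obtain ⟨N', hN'⟩ := exists_le_of_le_kappa h (div_pos (h.phi_pos hhalf) hψ2)
  set N := max N' 2 with hN
  have hN2 : 2 ≤ N := le_max_right _ _
  have hN0 : 0 < N := by linarith
  set a := 1 / (2 * N) with ha
  have ha0 : 0 < a := by positivity
  have ha1 : a ≤ 1 / 4 := by
    rw [ha]; apply one_div_le_one_div_of_le <;> linarith
  obtain ⟨C, hC, hdist⟩ := exists_distortion_bound h h3 (a := a) ⟨ha0, by linarith⟩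
  obtain ⟨z₁, hz₁, p, hp, htail⟩ := hd.exists_tail_ge hβ hβ₀ hβ₁ hC ha0
  have hz₁' : (1 + z₁) / 2 ∈ Ioo (0 : ℝ) 1 := ⟨by linarith [hz₁.1], by linarith [hz₁.2]⟩
  set P := min (tail c₀ ((1 + z₁) / 2)) (p / 2) with hP
  have hP0 : 0 < P := lt_min (hd.tail_pos _ (Ioo_subset_Ico_self hz₁')) (by positivity)
  have hw00 : 0 < tail c₀ 0 := hd.tail_pos 0 (by simp)
  have hw02 : 0 < tail c₀ (1 / 2) := hd.tail_pos _ (Ioo_subset_Ico_self hhalf)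
  refine ⟨max (2 * tail c₀ 0 / tail c₀ (1 / 2)) (2 * N / P), lt_max_of_lt_right (by positivity), ?_⟩
  intro w κ hs t ht x hx
  have hinit : ∀ y ∈ Ioo (0 : ℝ) 1, w y 0 = tail c₀ y := fun y hy =>
    hs.initial y (Ioo_subset_Ico_self hy)
  have hwt : w (1 / 2) t ≤ 2 := by linarith [hs.mul_le_one ht hhalf]
  obtain ⟨Z, hZ, hZt, hZm, hwZ⟩ := hs.exists_backward h le_rfl ht hhalf
  obtain ⟨s, hst, hZs, hZr⟩ := exists_first_time ht hZ.continuousOn hZt.le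
  rcases hst.1.eq_or_lt with hs0 | hs0
  · -- the curve through `(1/2, t)` starts in `(0, 1/2]`
    refine le_trans ?_ (le_max_left _ _)
    rw [← hs0] at hZs
    obtain ⟨X, -, -, hXm, hwX⟩ := hs.exists_backward h le_rfl ht hx
    have hX0 := hXm 0 (left_mem_Icc.2 ht)
    have hZ0 := hZm 0 (left_mem_Icc.2 ht)
    rw [hinit _ hX0] at hwX
    rw [hinit _ hZ0] at hwZ
    have e₁ : tail c₀ (X 0) ≤ tail c₀ 0 :=
      hd.antitoneOn_tail (by simp) (Ioo_subset_Icc_self hX0) hX0.1.le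
    have e₂ : tail c₀ (1 / 2) ≤ tail c₀ (Z 0) :=
      hd.antitoneOn_tail (Ioo_subset_Icc_self hZ0) (Ioo_subset_Icc_self hhalf) hZs
    rw [le_div_iff₀ hw02]
    have hE := Real.exp_pos (t - 0)
    have e₃ : Real.exp (t - 0) * tail c₀ (1 / 2) ≤ 2 :=
      (mul_le_mul_of_nonneg_left e₂ hE.le).trans (hwZ ▸ hwt)
    rw [hwX]
    calc Real.exp (t - 0) * tail c₀ (X 0) * tail c₀ (1 / 2)
        = tail c₀ (X 0) * (Real.exp (t - 0) * tail c₀ (1 / 2)) := by ring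
      _ ≤ tail c₀ 0 * 2 := mul_le_mul e₁ e₃ (by positivity) hw00.le
      _ = 2 * tail c₀ 0 := by ring
  -- otherwise it reaches `1/2` from the right at time `s`, so `κ s` is not small
  refine le_trans ?_ (le_max_right _ _)
  have hs0' := hs0.le
  have hZ' : IsCharacteristic φ ψ κ 0 s Z := hZ.mono le_rfl hst.2
  have hss : s ∈ Icc 0 s := right_mem_Icc.2 hs0'
  have hZs' : Z s = 1 / 2 := by
    refine le_antisymm hZs ?_
    have hc : Tendsto Z (𝓝[<] s) (𝓝 (Z s)) :=
      ((hZ'.continuousOn s hss).mono_of_mem_nhdsWithin (Icc_mem_nhdsLT hs0))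
    refine ge_of_tendsto hc ?_
    filter_upwards [Ioo_mem_nhdsLT hs0] with r hr using (hZr r ⟨hr.1.le, hr.2⟩).le
  have hZge : ∀ r ∈ Icc 0 s, 1 / 2 ≤ Z r := fun r hr => by
    rcases hr.2.eq_or_lt with rfl | hlt
    · exact hZs'.ge
    · exact (hZr r ⟨hr.1, hlt⟩).le
  have hκs : φ (1 / 2) / ψ (1 / 2) ≤ κ s := by
    have hder := (hZ' s hss).2
    rw [hZs'] at hder
    have hder' : HasDerivWithinAt Z (φ (1 / 2) - κ s * ψ (1 / 2)) (Iio s) s :=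
      hder.mono_of_mem_nhdsWithin (Icc_mem_nhdsLT hs0)
    rw [hasDerivWithinAt_iff_tendsto_slope' (by simp)] at hder'
    have : φ (1 / 2) - κ s * ψ (1 / 2) ≤ 0 := by
      refine le_of_tendsto hder' ?_
      filter_upwards [Ioo_mem_nhdsLT hs0] with r hr
      rw [slope_def_field, hZs']
      exact div_nonpos_of_nonneg_of_nonpos (by linarith [hZr r ⟨hr.1.le, hr.2⟩])
        (by linarith [hr.2])
    rw [div_le_iff₀ hψ2]
    linarith
  have hwN : ∀ y ∈ Ioo (0 : ℝ) 1, w y s ≤ N := fun y hy =>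
    (hN' c₀ w κ hs s hs0' hκs y hy).trans (le_max_left _ _)
  have hwa : 1 / 2 ≤ w a s := hs.half_le hs0' (by linarith) hwN
  obtain ⟨X, hX, hXs, hXm, hwX⟩ := hs.exists_backward h le_rfl hs0'
    (x := a / 2) ⟨by linarith, by linarith⟩
  obtain ⟨Y, hY, hYs, hYm, hwY⟩ := hs.exists_backward h le_rfl hs0'
    (x := a) ⟨by linarith, by linarith⟩
  have hl0 : (0 : ℝ) ∈ Icc 0 s := left_mem_Icc.2 hs0'
  have hX0 := hXm 0 hl0
  have hY0 := hYm 0 hl0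
  have hZ0 := hZm 0 (left_mem_Icc.2 ht)
  obtain ⟨hXY, hYZ, hr₁, hr₂⟩ := hdist κ s hs0'
    (hs.continuousOn_kappa.mono fun r hr => hr.1) (fun r hr => hs.kappa_pos h hr.1)
    X Y Z hX hY hZ' (fun r hr => (hXm r hr).1) (fun r hr => (hYm r hr).1) hZge hXs hYs hZs'
  have hwZs := hs.eq_exp_mul le_rfl hs0' hZ'
  rw [hZs', hinit _ hZ0] at hwZs
  rw [hinit _ hX0] at hwX
  rw [hinit _ hY0] at hwY
  have hE1 : 1 ≤ Real.exp (s - 0) := Real.one_le_exp (by linarith)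
  have hE0 : 0 < Real.exp (s - 0) := Real.exp_pos _
  have hPw : P ≤ w (1 / 2) s := by
    rw [hwZs]
    rcases lt_or_ge (X 0) z₁ with hlt | hge
    · have e₁ : tail c₀ ((1 + z₁) / 2) ≤ tail c₀ (Z 0) :=
        hd.antitoneOn_tail (Ioo_subset_Icc_self hZ0) (Ioo_subset_Icc_self hz₁') (by linarith)
      have e₂ : P ≤ tail c₀ (Z 0) := (min_le_left _ _).trans e₁
      calc P ≤ 1 * tail c₀ (Z 0) := by rwa [one_mul]
        _ ≤ Real.exp (s - 0) * tail c₀ (Z 0) :=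
          mul_le_mul_of_nonneg_right hE1 (hP0.le.trans e₂)
    · have hXN := hwN (a / 2) ⟨by linarith, by linarith⟩
      rw [hwX] at hXN
      rw [hwY] at hwa
      have e₁ : a * tail c₀ (X 0) ≤ tail c₀ (Y 0) := by
        refine le_of_mul_le_mul_left ?_ hE0
        calc Real.exp (s - 0) * (a * tail c₀ (X 0)) = a * (Real.exp (s - 0) * tail c₀ (X 0)) := by
              ring
          _ ≤ a * N := by gcongr
          _ = 1 / 2 := by rw [ha]; field_simp
          _ ≤ _ := hwa
      have e₂ := htail (X 0) (Y 0) (Z 0) hge hXY hYZ hZ0.2 hr₁ hr₂ e₁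
      have e₃ : tail c₀ (Y 0) ≤ tail c₀ (X 0) :=
        hd.antitoneOn_tail (Ioo_subset_Icc_self hX0) (Ioo_subset_Icc_self hY0) hXY.le
      calc P ≤ p * (1 / 2) := (min_le_right _ _).trans (by linarith)
        _ ≤ p * (Real.exp (s - 0) * tail c₀ (X 0)) := by
            gcongr
            exact hwa.trans (by gcongr)
        _ = Real.exp (s - 0) * (p * tail c₀ (X 0)) := by ring
        _ ≤ Real.exp (s - 0) * tail c₀ (Z 0) := by gcongr
  -- compare `w (x, t)` with `w (1/2, t)` through their values at time `s`
  obtain ⟨V, -, -, hVm, hwV⟩ := hs.exists_backward h hs0' hst.2 hx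
  have hVN := hwN _ (hVm s (left_mem_Icc.2 hst.2))
  have hwZt := hs.eq_exp_mul hs0' hst.2 (hZ.mono hs0' le_rfl)
  rw [hZs', hZt] at hwZt
  have hE := Real.exp_pos (t - s)
  have e₁ : Real.exp (t - s) * P ≤ 2 := by
    refine le_trans ?_ hwt
    rw [hwZt]
    gcongr
  rw [hwV, le_div_iff₀ hP0]
  calc Real.exp (t - s) * w (V s) s * P ≤ Real.exp (t - s) * N * P := by gcongr
    _ = N * (Real.exp (t - s) * P) := by ring
    _ ≤ N * 2 := by gcongr
    _ = 2 * N := by ring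

end UniformBound

end LSW

theorem corollary4p1 (φ ψ c₀ : ℝ → ℝ) (β₀ : ℝ)
    (hcoef : LSW.IsCoefficientPair φ ψ)
    (hthird : LSW.HasSignedThirdDerivatives φ ψ)
    (hφ : Filter.Tendsto (fun x => φ x / x) (nhdsWithin 0 (Set.Ioi 0)) Filter.atTop)
    (hdata : LSW.IsInitialDensity c₀)
    (hβ : Filter.Tendsto (LSW.betaFunction c₀) (nhdsWithin 1 (Set.Iio 1)) (nhds β₀))
    (hβ₀_pos : 0 < β₀) (hβ₀_le : β₀ ≤ 1) :
    ∃ C : ℝ, 0 < C ∧ ∀ (w : ℝ → ℝ → ℝ) (κ : ℝ → ℝ), LSW.IsSolution φ ψ c₀ w κ →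
      ∀ t : ℝ, 0 ≤ t → C ≤ κ t := by
  obtain ⟨N, hN, hw⟩ := LSW.exists_uniform_bound hcoef hthird hdata hβ hβ₀_pos hβ₀_le
  have hψ : 0 < ψ 0 := hcoef.psi_pos (by simp)
  refine ⟨1 / (ψ 0 * N), by positivity, fun w κ hs t ht => ?_⟩
  rw [div_le_iff₀ (by positivity), ← mul_assoc]
  exact hs.one_le_kappa_mul hcoef ht (hw w κ hs t ht)
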